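/- **Setting.** Let $G$ be a simply connected six-dimensional real Lie group with Lie algebra $\mathfrak g$, let $\Gamma\subset G$ be a lattice such that $M=\Gamma\backslash G$ is compact, let $J$ be an invariant complex structure on $M$ (i.e. induced by an integrable $J$ on $\mathfrak g$) for which $\mathfrak g$ has a non-zero closed $(3,0)$-form, and let $g$ be an invariant $J$-Hermitian metric on $M$ with fundamental form $F=g(J\cdot,\cdot)$. For $\alpha\in\mathfrak g^*$ put $d\alpha(X,Y)=-\alpha([X,Y])$; write $\mathfrak g\cong(de^1,\dots,de^6)$ if $\mathfrak g^*$ has a basis $e^1,\dots,e^6$ with these differentials, where $ij$ stands for $e^i\wedge e^j$: $$\begin{aligned} \mathfrak h_5&=(0,0,0,0,13+42,14+23),\\ \mathfrak g_1&=(15,-25,-35,45,0,0),\\ \mathfrak g_2^{\alpha}&=(\alpha\cdot 15+25,\,-15+\alpha\cdot 25,\,-\alpha\cdot 35+45,\,-35-\alpha\cdot 45,\,0,\,0),\\ \mathfrak g_8&=(16-25,\,15+26,\,-36+45,\,-35-46,\,0,\,0),\\ \mathfrak{so}(3,1)&=(23-56,\,-13+46,\,12-45,\,26-35,\,-16+34,\,15-24).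 \end{aligned}$$ The Chern connection $\nabla^c$ of $(J,g)$ is the connection on $TM$ with $\nabla^c g=0$, $\nabla^c J=0$ and torsion with vanishing $(1,1)$-part, $T(JX,JY)=-T(X,Y)$. A connection with curvature $\Omega$ is an *instanton* if $\Omega\wedge F^2=0$ and $\Omega^{2,0}=\Omega^{0,2}=0$. The metric is *balanced* if $dF^2=0$ and *Kähler* if $dF=0$. The structure $J$ is *complex parallelizable* if $[JX,Y]=J[X,Y]$ for all $X,Y\in\mathfrak g$. The metric is called *diagonal* if there are a basis $\omega^1,\omega^2,\omega^3$ of the invariant $(1,0)$-forms, constants $K,L\in\mathbb C$ and non-zero reals $r_1,r_2,r_3$ with $$d\omega^1=K\,\omega^1\wedge\omega^3+L\,\omega^1\wedge\bar\omega^3,\qquad d\omega^2=-K\,\omega^2\wedge\omega^3-L\,\omega^2\wedge\bar\omega^3,\qquad d\omega^3=0,$$ $$2F=i\,(r_1^2\,\omega^1\wedge\bar\omega^1+r_2^2\,\omega^2\wedge\bar\omega^2+r_3^2\,\omega^3\wedge\bar\omega^3).$$ **Statement.** The Chern connection $\nabla^c$ is an instanton, and moreover it is flat, in each of the following cases: 1.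 $\mathfrak g\cong\mathfrak h_5$, $\mathfrak g_8$ or $\mathfrak{so}(3,1)$, $J$ is complex parallelizable and $g$ is any invariant Hermitian metric; in this case $g$ is moreover always balanced; 2. $\mathfrak g\cong\mathfrak g_1$, $\mathfrak g_2^{\alpha}$ for some $\alpha>0$, or $\mathfrak g_8$, $J$ is any such complex structure and $g$ is any diagonal metric; 3. $\mathfrak g\cong\mathfrak g_2^{0}$, $J$ is any such complex structure and $g$ is any Kähler metric. -/

import Mathlib

open scoped Manifold ContDiff Bundle
open Module

noncomputable section

/-! ### Invariant forms on a real Lie algebra -/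

namespace LieForms

variable {L : Type*} [LieRing L] [LieAlgebra ℝ L]
variable {A : Type*} [CommRing A] [Algebra ℝ A]

/-- The differential of a one-form, `dα(X, Y) = -α([X, Y])`. -/
def dOne (α : L →ₗ[ℝ] A) : L → L → A := fun X Y => -α ⁅X, Y⁆

/-- The wedge product of two one-forms. -/
def wedge (α β : L →ₗ[ℝ] A) : L → L → A := fun X Y => α X * β Y - α Y * β X

/-- The Chevalley–Eilenberg differential of an `(n+1)`-form,
`dη(X₀, …, Xₙ₊₁) = ∑_{i < j} (-1)^{i+j} η([Xᵢ, Xⱼ], X₀, …, X̂ᵢ, …, X̂ⱼ, …, Xₙ₊₁)`. -/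
def ceD {n : ℕ} (η : (Fin (n + 1) → L) → A) : (Fin (n + 2) → L) → A := fun X =>
  ∑ j : Fin (n + 2), ∑ i : Fin (n + 1),
    if i.castSucc < j then
      (-1 : A) ^ ((i : ℕ) + (j : ℕ)) *
        η (Fin.cons ⁅X i.castSucc, X j⁆ fun k => X (j.succAbove (i.succAbove k)))
    else 0

end LieForms

/-! ### The Lie algebras, given by the structure equations of a coframe

The one-forms `e¹, …, e⁶` are `e 0, …, e 5`. -/

namespace SixDim

open LieForms

variable (L : Type*) [LieRing L] [LieAlgebra ℝ L]

/-- `𝔥₅ = (0, 0, 0, 0, 13 + 42, 14 + 23)`. -/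
def IsH5 : Prop :=
  ∃ e : Basis (Fin 6) ℝ (L →ₗ[ℝ] ℝ),
    dOne (e 0) = 0 ∧ dOne (e 1) = 0 ∧ dOne (e 2) = 0 ∧ dOne (e 3) = 0 ∧
    dOne (e 4) = wedge (e 0) (e 2) + wedge (e 3) (e 1) ∧
    dOne (e 5) = wedge (e 0) (e 3) + wedge (e 1) (e 2)

/-- `𝔤₁ = (15, -25, -35, 45, 0, 0)`. -/
def IsG1 : Prop :=
  ∃ e : Basis (Fin 6) ℝ (L →ₗ[ℝ] ℝ),
    dOne (e 0) = wedge (e 0) (e 4) ∧ dOne (e 1) = -wedge (e 1) (e 4) ∧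
    dOne (e 2) = -wedge (e 2) (e 4) ∧ dOne (e 3) = wedge (e 3) (e 4) ∧
    dOne (e 4) = 0 ∧ dOne (e 5) = 0

/-- `𝔤₂^α = (α·15 + 25, -15 + α·25, -α·35 + 45, -35 - α·45, 0, 0)`. -/
def IsG2 (α : ℝ) : Prop :=
  ∃ e : Basis (Fin 6) ℝ (L →ₗ[ℝ] ℝ),
    dOne (e 0) = α • wedge (e 0) (e 4) + wedge (e 1) (e 4) ∧
    dOne (e 1) = -wedge (e 0) (e 4) + α • wedge (e 1) (e 4) ∧
    dOne (e 2) = -(α • wedge (e 2) (e 4)) + wedge (e 3) (e 4) ∧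
    dOne (e 3) = -wedge (e 2) (e 4) - α • wedge (e 3) (e 4) ∧
    dOne (e 4) = 0 ∧ dOne (e 5) = 0

/-- `𝔤₈ = (16 - 25, 15 + 26, -36 + 45, -35 - 46, 0, 0)`. -/
def IsG8 : Prop :=
  ∃ e : Basis (Fin 6) ℝ (L →ₗ[ℝ] ℝ),
    dOne (e 0) = wedge (e 0) (e 5) - wedge (e 1) (e 4) ∧
    dOne (e 1) = wedge (e 0) (e 4) + wedge (e 1) (e 5) ∧
    dOne (e 2) = -wedge (e 2) (e 5) + wedge (e 3) (e 4) ∧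
    dOne (e 3) = -wedge (e 2) (e 4) - wedge (e 3) (e 5) ∧
    dOne (e 4) = 0 ∧ dOne (e 5) = 0

/-- `𝔰𝔬(3,1) = (23 - 56, -13 + 46, 12 - 45, 26 - 35, -16 + 34, 15 - 24)`. -/
def IsSO31 : Prop :=
  ∃ e : Basis (Fin 6) ℝ (L →ₗ[ℝ] ℝ),
    dOne (e 0) = wedge (e 1) (e 2) - wedge (e 4) (e 5) ∧
    dOne (e 1) = -wedge (e 0) (e 2) + wedge (e 3) (e 5) ∧
    dOne (e 2) = wedge (e 0) (e 1) - wedge (e 3) (e 4) ∧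
    dOne (e 3) = wedge (e 1) (e 5) - wedge (e 2) (e 4) ∧
    dOne (e 4) = -wedge (e 0) (e 5) + wedge (e 2) (e 3) ∧
    dOne (e 5) = wedge (e 0) (e 4) - wedge (e 1) (e 3)

end SixDim

/-! ### Complex structures and Hermitian metrics on a Lie algebra -/

namespace LieHermitian

open LieForms

variable {L : Type*} [LieRing L] [LieAlgebra ℝ L]

/-- An integrable almost complex structure. -/
structure IsComplexStructure (J : L →ₗ[ℝ] L) : Prop where
  sq : ∀ X, J (J X) = -X
  nijenhuis : ∀ X Y, ⁅J X, J Y⁆ - J ⁅X, J Y⁆ - J ⁅J X, Y⁆ - ⁅X, Y⁆ = 0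

/-- There is a non-zero closed `(3,0)`-form. -/
def HasClosedThreeZeroForm (J : L →ₗ[ℝ] L) : Prop :=
  ∃ Ψ : L [⋀^Fin 3]→ₗ[ℝ] ℂ, Ψ ≠ 0 ∧
    (∀ (v : Fin 3 → L) (k : Fin 3),
      Ψ (Function.update v k (J (v k))) = Complex.I * Ψ v) ∧
    ceD (fun v => Ψ v) = 0

/-- `J` is complex parallelizable: the bracket is complex bilinear, so that `J` makes the Lie
algebra into a complex Lie algebra. -/
def IsComplexParallelizable (J : L →ₗ[ℝ] L) : Prop :=
  ∀ X Y, ⁅J X, Y⁆ = J ⁅X, Y⁆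

/-- `g` is a `J`-Hermitian inner product. -/
structure IsHermitianMetric (J : L →ₗ[ℝ] L) (g : L →ₗ[ℝ] L →ₗ[ℝ] ℝ) : Prop where
  symm : ∀ X Y, g X Y = g Y X
  pos : ∀ X, X ≠ 0 → 0 < g X X
  compat : ∀ X Y, g (J X) (J Y) = g X Y

/-- The fundamental form `F(X, Y) = g(JX, Y)`; it is of the form `(i/2) ∑ ηᵏ ∧ η̄ᵏ` in a unitary
basis of forms `ηᵏ` with `ηᵏ(JX) = i ηᵏ(X)`. -/
def fundForm (J : L →ₗ[ℝ] L) (g : L →ₗ[ℝ] L →ₗ[ℝ] ℝ) (X Y : L) : ℝ := g (J X) Y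

/-- The four-form `F ∧ F`. -/
def fundFormSq (J : L →ₗ[ℝ] L) (g : L →ₗ[ℝ] L →ₗ[ℝ] ℝ) (v : Fin 4 → L) : ℝ :=
  2 * (fundForm J g (v 0) (v 1) * fundForm J g (v 2) (v 3)
    - fundForm J g (v 0) (v 2) * fundForm J g (v 1) (v 3)
    + fundForm J g (v 0) (v 3) * fundForm J g (v 1) (v 2))

/-- The metric is balanced: `d(F ∧ F) = 0` (complex dimension three). -/
def IsBalanced (J : L →ₗ[ℝ] L) (g : L →ₗ[ℝ] L →ₗ[ℝ] ℝ) : Prop :=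
  ceD (fundFormSq J g) = 0

/-- The metric is Kähler: `dF = 0`. -/
def IsKahler (J : L →ₗ[ℝ] L) (g : L →ₗ[ℝ] L →ₗ[ℝ] ℝ) : Prop :=
  ceD (fun v : Fin 2 → L => fundForm J g (v 0) (v 1)) = 0

/-- The complex conjugate of a complex-valued one-form. -/
def conjForm (η : L →ₗ[ℝ] ℂ) : L →ₗ[ℝ] ℂ := Complex.conjAe.toLinearMap ∘ₗ η

/-- The metric is *diagonal*: there is a `(1,0)`-basis `η¹, η², η³` (here `η 0, η 1, η 2`) in which
the complex structure equations are
`dη¹ = K η¹∧η³ + M η¹∧η̄³`, `dη² = -K η²∧η³ - M η²∧η̄³`, `dη³ = 0` with constants `K`, `M`,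
and `2F = i (r₁² η¹∧η̄¹ + r₂² η²∧η̄² + r₃² η³∧η̄³)`. -/
def IsDiagonal (J : L →ₗ[ℝ] L) (g : L →ₗ[ℝ] L →ₗ[ℝ] ℝ) : Prop :=
  ∃ (η : Fin 3 → (L →ₗ[ℝ] ℂ)) (K M : ℂ) (r : Fin 3 → ℝ),
    LinearIndependent ℂ η ∧ (∀ k X, η k (J X) = Complex.I * η k X) ∧
    dOne (η 0) = K • wedge (η 0) (η 2) + M • wedge (η 0) (conjForm (η 2)) ∧
    dOne (η 1) = -(K • wedge (η 1) (η 2)) - M • wedge (η 1) (conjForm (η 2)) ∧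
    dOne (η 2) = 0 ∧
    (∀ k, r k ≠ 0) ∧
    ∀ X Y, 2 * (fundForm J g X Y : ℂ) =
      Complex.I * ∑ k, (r k : ℂ) ^ 2 * wedge (η k) (conjForm (η k)) X Y

end LieHermitian

/-! ### Lie groups of dimension six and their quotients -/

/-- The model space `ℝ⁶`. -/
abbrev E6 : Type := EuclideanSpace ℝ (Fin 6)

/-- A smooth real Lie group is a Lie group in the sense required for its Lie algebra. -/
instance instLieGroupMinSmoothness {G : Type*} [TopologicalSpace G] [ChartedSpace E6 G] [Group G]
    [LieGroup (𝓡 6) ∞ G] : LieGroup (𝓡 6) (minSmoothness ℝ 3) G :=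
  LieGroup.of_le (n := ∞) (by
    rw [minSmoothness_of_isRCLikeNormedField]
    exact mod_cast ENat.LEInfty.out)

namespace HomogeneousSpace

variable {G : Type*} [TopologicalSpace G] [ChartedSpace E6 G] [Group G]
variable {M : Type*} [TopologicalSpace M] [ChartedSpace E6 M]

/-- `p : G → M` exhibits the smooth manifold `M` as the quotient `Γ\G` by left translations. -/
structure IsQuotientBy (Γ : Subgroup G) (p : G → M) : Prop where
  localDiffeo : IsLocalDiffeomorph (𝓡 6) (𝓡 6) ∞ p
  surjective : Function.Surjective p
  fiber : ∀ a b : G, p a = p b ↔ ∃ γ ∈ Γ, b = γ * a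

/-- The value at `p a` of the vector field on `Γ\G` induced by the left-invariant vector field
with value `v` at the identity. -/
def frame (p : G → M) (a : G) (v : GroupLieAlgebra (𝓡 6) G) : TangentSpace (𝓡 6) (p a) :=
  mfderiv (𝓡 6) (𝓡 6) p a (mulInvariantVectorField v a)

/-- The field of endomorphisms `J` of `TM` is invariant and induced by `J₀` on the Lie algebra. -/
def IsInducedEnd (p : G → M)
    (J₀ : GroupLieAlgebra (𝓡 6) G →ₗ[ℝ] GroupLieAlgebra (𝓡 6) G)
    (J : ∀ x : M, TangentSpace (𝓡 6) x →ₗ[ℝ] TangentSpace (𝓡 6) x) : Prop :=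
  ∀ a v, J (p a) (frame p a v) = frame p a (J₀ v)

/-- The metric `g` on `M` is invariant and induced by `g₀` on the Lie algebra. -/
def IsInducedMetric (p : G → M)
    (g₀ : GroupLieAlgebra (𝓡 6) G →ₗ[ℝ] GroupLieAlgebra (𝓡 6) G →ₗ[ℝ] ℝ)
    (g : ∀ x : M, TangentSpace (𝓡 6) x →ₗ[ℝ] TangentSpace (𝓡 6) x →ₗ[ℝ] ℝ) : Prop :=
  ∀ a v w, g (p a) (frame p a v) (frame p a w) = g₀ v w

end HomogeneousSpace

/-! ### Connections on a six-dimensional Hermitian manifold -/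

namespace HermitianManifold

variable {M : Type*} [TopologicalSpace M] [ChartedSpace E6 M] [IsManifold (𝓡 6) ∞ M]

/-- A linear connection on `TM`; `D Y x v` is `∇_v Y` at `x`. -/
abbrev Connection (M : Type*) [TopologicalSpace M] [ChartedSpace E6 M]
    [IsManifold (𝓡 6) ∞ M] :=
  CovariantDerivative (𝓡 6) E6 (TangentSpace (𝓡 6) : M → Type _)

/-- The vector field `Y` is differentiable at `x`. -/
def IsDiffAt (Y : ∀ x : M, TangentSpace (𝓡 6) x) (x : M) : Prop :=
  MDifferentiableAt (𝓡 6) (𝓡 6).tangent (fun y => (⟨y, Y y⟩ : TangentBundle (𝓡 6) M)) x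

/-- A smooth vector field. -/
def IsSmoothField (X : ∀ x : M, TangentSpace (𝓡 6) x) : Prop :=
  ContMDiff (𝓡 6) (𝓡 6).tangent ∞ (fun y => (⟨y, X y⟩ : TangentBundle (𝓡 6) M))

/-- The Chern connection of `(J, g)`: `∇g = 0`, `∇J = 0`, and the `(1,1)`-part of the torsion
vanishes, i.e. `T(JX, JY) = -T(X, Y)`. -/
structure IsChernConnection
    (J : ∀ x : M, TangentSpace (𝓡 6) x →ₗ[ℝ] TangentSpace (𝓡 6) x)
    (g : ∀ x : M, TangentSpace (𝓡 6) x →ₗ[ℝ] TangentSpace (𝓡 6) x →ₗ[ℝ] ℝ)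
    (D : Connection M) : Prop where
  metric : ∀ (Y Z : ∀ x : M, TangentSpace (𝓡 6) x) (x : M),
    IsDiffAt Y x → IsDiffAt Z x → ∀ v : TangentSpace (𝓡 6) x,
      mvfderiv (𝓡 6) (fun y => g y (Y y) (Z y)) x v = g x (D Y x v) (Z x) + g x (Y x) (D Z x v)
  parallel : ∀ (Y : ∀ x : M, TangentSpace (𝓡 6) x) (x : M),
    IsDiffAt Y x → ∀ v : TangentSpace (𝓡 6) x,
      D (fun y => J y (Y y)) x v = J x (D Y x v)
  torsion : ∀ (x : M) (v w : TangentSpace (𝓡 6) x),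
    D.torsion x (J x v) (J x w) = -D.torsion x v w

/-- The curvature `R(X, Y)Z = ∇_X ∇_Y Z - ∇_Y ∇_X Z - ∇_{[X, Y]} Z`. -/
def curvature (D : Connection M) (X Y Z : ∀ x : M, TangentSpace (𝓡 6) x) (x : M) :
    TangentSpace (𝓡 6) x :=
  D (fun y => D Z y (Y y)) x (X x) - D (fun y => D Z y (X y)) x (Y x)
    - D Z x (VectorField.mlieBracket (𝓡 6) X Y x)

/-- The connection is flat. -/
def IsFlat (D : Connection M) : Prop :=
  ∀ X Y Z : ∀ x : M, TangentSpace (𝓡 6) x,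
    IsSmoothField X → IsSmoothField Y → IsSmoothField Z → ∀ x, curvature D X Y Z x = 0

/-- The connection is an instanton (Hermitian-Yang-Mills): its curvature `Ω` satisfies
`Ω^{2,0} = Ω^{0,2} = 0`, i.e. `Ω(JX, JY) = Ω(X, Y)`, and `Ω ∧ F² = 0`, where `F = g(J·, ·)`.
The sum over permutations is a non-zero multiple of `(Ω ∧ F ∧ F)(V₀, …, V₅)`. -/
structure IsInstanton
    (J : ∀ x : M, TangentSpace (𝓡 6) x →ₗ[ℝ] TangentSpace (𝓡 6) x)
    (g : ∀ x : M, TangentSpace (𝓡 6) x →ₗ[ℝ] TangentSpace (𝓡 6) x →ₗ[ℝ] ℝ)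
    (D : Connection M) : Prop where
  typeOneOne : ∀ X Y Z : ∀ x : M, TangentSpace (𝓡 6) x,
    IsSmoothField X → IsSmoothField Y → IsSmoothField Z →
      ∀ x, curvature D (fun y => J y (X y)) (fun y => J y (Y y)) Z x = curvature D X Y Z x
  primitive : ∀ (V : Fin 6 → ∀ x : M, TangentSpace (𝓡 6) x) (Z : ∀ x : M, TangentSpace (𝓡 6) x),
    (∀ k, IsSmoothField (V k)) → IsSmoothField Z → ∀ x,
      ∑ σ : Equiv.Perm (Fin 6),
        (((Equiv.Perm.sign σ : ℤ) : ℝ) *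
          (g x (J x (V (σ 2) x)) (V (σ 3) x) * g x (J x (V (σ 4) x)) (V (σ 5) x))) •
          curvature D (V (σ 0)) (V (σ 1)) Z x = 0

end HermitianManifold

end

/-!
The left-invariant vector fields of `G` descend to a global frame `E_v`, `v ∈ 𝔤`, of `TM` with
`[E_v, E_w] = E_[v, w]` (`isInvariantFrame_quotientFrame`). In this frame `J` and `g` have the
constant coefficients `J₀` and `g₀`, so the Chern connection is a problem of linear algebra on `𝔤`.

In all the cases the Chern connection has the form `∇_{E_v} E_w = φ(v) E_{Bw}` with a closed
one-form `φ` and a skew-Hermitian endomorphism `B` (`IsFlatChernForm`). Its connection form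
`φ ⊗ B` takes values in a line, so its curvature is `dφ ⊗ B = 0` (`curvature_eq_zero`). Conversely,
if `φ` and `B` are such that the torsion has no `(1,1)`-part, the uniqueness of the Chern connection
(`eq_zero_of_skew_of_torsion`) identifies it with the given one. A flat connection is an instanton.

It remains to find `φ` and `B`.
* If `J₀` is complex parallelizable, then `φ = 0` and `B = 0`: the bracket is complex bilinear, so
  the connection for which the frame is parallel has torsion of type `(2,0) + (0,2)`.
* If the metric is diagonal, then `B` has the eigenvalues `i, -i, 0` on the basis dual to
  `η¹, η², η³`, and `φ = 2 Im (c η̄³)`, where `c η¹ ∧ η̄³` is the `(1,1)`-part of `dη¹`.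
* If the metric on `𝔤₂⁰` is Kähler, let `Z` span the centre. Then `T = J₀ Z` is orthogonal to the
  abelian ideal `ker e⁵`, and `B = ad T` and `φ = e⁵ / e⁵(T)` give the Levi-Civita connection,
  which is the Chern connection.

In the complex parallelizable case the metric is balanced because `𝔤` is unimodular: `d(F ∧ F)` on
five vectors of a unitary basis is the trace of `ad x`, where `x` is `J₀` of the omitted vector, up
to a factor.
-/

noncomputable section

/-! ### Vector fields and derivations on a manifold -/

section Calculus
open VectorField HermitianManifold

variable {M : Type*} [TopologicalSpace M] [ChartedSpace E6 M]

lemma mvfderiv_finset_sum {ι : Type} (s : Finset ι) {f : ι → M → ℝ} {x : M}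
    (hf : ∀ i ∈ s, MDifferentiableAt (𝓡 6) 𝓘(ℝ, ℝ) (f i) x) :
    mvfderiv (𝓡 6) (∑ i ∈ s, f i) x = ∑ i ∈ s, mvfderiv (𝓡 6) (f i) x := by
  classical
  induction s using Finset.induction_on with
  | empty => simp
  | insert a s ha ih =>
    have hs : MDifferentiableAt (𝓡 6) 𝓘(ℝ, ℝ) (∑ i ∈ s, f i) x :=
      MDifferentiableAt.sum fun i hi => hf i (Finset.mem_insert_of_mem hi)
    rw [Finset.sum_insert ha, Finset.sum_insert ha, mvfderiv_add (hf a (by simp)) hs,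
      ih fun i hi => hf i (by simp [hi])]

variable [IsManifold (𝓡 6) ∞ M]

/-- A vector field of class `C²`. Invariant fields are handled at this regularity: it is all that
second derivatives and the Jacobi identity for the bracket need. -/
def IsC2Field (X : ∀ x : M, TangentSpace (𝓡 6) x) : Prop :=
  ContMDiff (𝓡 6) (𝓡 6).tangent 2 (fun y => (⟨y, X y⟩ : TangentBundle (𝓡 6) M))

lemma isManifold_minSmoothness (k : ℕ∞) : IsManifold (𝓡 6) (minSmoothness ℝ k) M := by
  rw [minSmoothness_of_isRCLikeNormedField]
  exact .of_le (n := ∞) (mod_cast le_top)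

lemma IsC2Field.isDiffAt {X : ∀ x : M, TangentSpace (𝓡 6) x} (hX : IsC2Field X) (x : M) :
    IsDiffAt X x := hX.contMDiffAt.mdifferentiableAt (by norm_num)

lemma mdifferentiableAt_mvfderiv_apply {f : M → ℝ} (hf : ContMDiff (𝓡 6) 𝓘(ℝ, ℝ) 2 f)
    {X : ∀ x : M, TangentSpace (𝓡 6) x} (hX : IsC2Field X) (x : M) :
    MDifferentiableAt (𝓡 6) 𝓘(ℝ, ℝ) (fun y => mvfderiv (𝓡 6) f y (X y)) x := by
  have h1 : ContMDiff (𝓡 6).tangent 𝓘(ℝ, ℝ).tangent 1 (tangentMap (𝓡 6) 𝓘(ℝ, ℝ) f) :=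
    hf.contMDiff_tangentMap (by norm_num)
  have h2 := h1.comp (hX.of_le (by norm_num : (1 : ℕ∞ω) ≤ 2))
  have h3 := (contMDiff_snd_tangentBundle_modelSpace ℝ 𝓘(ℝ, ℝ)).comp h2
  exact h3.contMDiffAt.mdifferentiableAt (by norm_num)

lemma isDiffAt_mlieBracket {X Y : ∀ x : M, TangentSpace (𝓡 6) x}
    (hX : IsC2Field X) (hY : IsC2Field Y) (x : M) : IsDiffAt (mlieBracket (𝓡 6) X Y) x := by
  have : IsManifold (𝓡 6) (((2 : ℕ∞) : ℕ∞ω) + 1) M := .of_le (n := ∞) (by exact mod_cast le_top)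
  have := isManifold_minSmoothness (M := M) 2
  have := isManifold_minSmoothness (M := M) 3
  have := ContMDiffAt.mlieBracket_vectorField (𝕜 := ℝ) (m := 1) (n := 2) (x := x)
    (hX.contMDiffAt) (hY.contMDiffAt) (by simp; norm_num)
  exact this.mdifferentiableAt (by norm_num)

/-- `[X, Y]f = X(Yf) - Y(Xf)`. Only the Leibniz rule and the Jacobi identity of the bracket are
used: expand `[[X, Y], fW] = [X, [Y, fW]] - [Y, [X, fW]]` and compare the coefficients of a
field `W` that does not vanish at the point. -/
lemma mvfderiv_mlieBracket {X Y W : ∀ x : M, TangentSpace (𝓡 6) x}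
    (hX : IsC2Field X) (hY : IsC2Field Y) (hW : IsC2Field W) {x : M} (hWx : W x ≠ 0)
    {f : M → ℝ} (hf : ContMDiff (𝓡 6) 𝓘(ℝ, ℝ) 2 f) :
    mvfderiv (𝓡 6) f x (mlieBracket (𝓡 6) X Y x) =
      mvfderiv (𝓡 6) (fun y => mvfderiv (𝓡 6) f y (Y y)) x (X x)
        - mvfderiv (𝓡 6) (fun y => mvfderiv (𝓡 6) f y (X y)) x (Y x) := by
  have := isManifold_minSmoothness (M := M) 2
  have := isManifold_minSmoothness (M := M) 3
  have hf1 : ∀ y, MDifferentiableAt (𝓡 6) 𝓘(ℝ, ℝ) f y := fun y =>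
    hf.contMDiffAt.mdifferentiableAt (by norm_num)
  have key : ∀ Z : ∀ x : M, TangentSpace (𝓡 6) x, mlieBracket (𝓡 6) Z (f • W) =
      (fun y => mvfderiv (𝓡 6) f y (Z y)) • W + f • mlieBracket (𝓡 6) Z W := fun Z => by
    ext1 y
    exact mlieBracket_smul_right (hf1 y) (hW.isDiffAt y)
  have key2 : ∀ Z Z' : ∀ x : M, TangentSpace (𝓡 6) x, IsC2Field Z → IsC2Field Z' →
      mlieBracket (𝓡 6) Z' (mlieBracket (𝓡 6) Z (f • W)) x =
      (mvfderiv (𝓡 6) (fun y => mvfderiv (𝓡 6) f y (Z y)) x (Z' x) • W x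
        + mvfderiv (𝓡 6) f x (Z x) • mlieBracket (𝓡 6) Z' W x)
      + (mvfderiv (𝓡 6) f x (Z' x) • mlieBracket (𝓡 6) Z W x
        + f x • mlieBracket (𝓡 6) Z' (mlieBracket (𝓡 6) Z W) x) := fun Z Z' hZ hZ' => by
    have hd := mdifferentiableAt_mvfderiv_apply hf hZ x
    have hb := isDiffAt_mlieBracket hZ hW x
    rw [key, mlieBracket_add_right, mlieBracket_smul_right hd (hW.isDiffAt x),
      mlieBracket_smul_right (hf1 x) hb]
    · exact hd.smul_section (hW.isDiffAt x)
    · exact (hf1 x).smul_section hb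
  have hm : minSmoothness ℝ 2 = 2 := minSmoothness_of_isRCLikeNormedField
  have hfW : IsC2Field (f • W) := hf.smul_section hW
  have j1 := leibniz_identity_mlieBracket_apply (𝕜 := ℝ) (I := 𝓡 6) (U := X) (V := Y) (W := W)
    (x := x) (by rw [hm]; exact hX.contMDiffAt) (by rw [hm]; exact hY.contMDiffAt)
    (by rw [hm]; exact hW.contMDiffAt)
  have j2 := leibniz_identity_mlieBracket_apply (𝕜 := ℝ) (I := 𝓡 6) (U := X) (V := Y) (W := f • W)
    (x := x) (by rw [hm]; exact hX.contMDiffAt) (by rw [hm]; exact hY.contMDiffAt)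
    (by rw [hm]; exact hfW.contMDiffAt)
  rw [key2 _ _ hY hX, key2 _ _ hX hY, key, j1] at j2
  simp only [Pi.add_apply, Pi.smul_apply', smul_add] at j2
  have : (mvfderiv (𝓡 6) f x (mlieBracket (𝓡 6) X Y x) -
      (mvfderiv (𝓡 6) (fun y => mvfderiv (𝓡 6) f y (Y y)) x (X x)
        - mvfderiv (𝓡 6) (fun y => mvfderiv (𝓡 6) f y (X y)) x (Y x))) • W x = 0 := by
    have h3 := sub_eq_zero.2 j2.symm
    rw [← h3]
    module
  exact sub_eq_zero.1 ((smul_eq_zero.1 this).resolve_right hWx)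

lemma isDiffAt_sum {ι : Type*} (s : Finset ι) {X : ι → ∀ x : M, TangentSpace (𝓡 6) x} {x : M}
    (hX : ∀ i ∈ s, IsDiffAt (X i) x) : IsDiffAt (∑ i ∈ s, X i) x := by
  simpa [IsDiffAt, Finset.sum_apply] using! MDifferentiableAt.sum_section hX

lemma isC2Field_sum {ι : Type*} (s : Finset ι) {X : ι → ∀ x : M, TangentSpace (𝓡 6) x}
    (hX : ∀ i ∈ s, IsC2Field (X i)) : IsC2Field (∑ i ∈ s, X i) := by
  simpa [IsC2Field, Finset.sum_apply] using! ContMDiff.sum_section hX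

lemma connection_sum (D : Connection M) {ι : Type*} (s : Finset ι)
    {X : ι → ∀ x : M, TangentSpace (𝓡 6) x} {x : M} (hX : ∀ i ∈ s, IsDiffAt (X i) x) :
    D (∑ i ∈ s, X i) x = ∑ i ∈ s, D (X i) x := by
  classical
  induction s using Finset.induction_on with
  | empty =>
    rw [Finset.sum_empty, Finset.sum_empty]
    exact D.isCovariantDerivativeOn.zero (Set.mem_univ x)
  | insert a s ha ih =>
    rw [Finset.sum_insert ha, Finset.sum_insert ha,
      D.isCovariantDerivativeOn.add (hX a (by simp))
        (isDiffAt_sum s fun i hi => hX i (by simp [hi])), ih fun i hi => hX i (by simp [hi])]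

lemma mlieBracket_sum_right {ι : Type*} (s : Finset ι) (Y : ∀ x : M, TangentSpace (𝓡 6) x)
    {X : ι → ∀ x : M, TangentSpace (𝓡 6) x} {x : M} (hX : ∀ i ∈ s, IsDiffAt (X i) x) :
    mlieBracket (𝓡 6) Y (∑ i ∈ s, X i) x = ∑ i ∈ s, mlieBracket (𝓡 6) Y (X i) x := by
  have := isManifold_minSmoothness (M := M) 2
  classical
  induction s using Finset.induction_on with
  | empty => simp
  | insert a s ha ih =>
    rw [Finset.sum_insert ha, Finset.sum_insert ha,
      mlieBracket_add_right (hX a (by simp))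
        (isDiffAt_sum s fun i hi => hX i (by simp [hi])), ih fun i hi => hX i (by simp [hi])]

end Calculus

/-! ### Connections in an invariant frame -/

section Frame
open VectorField HermitianManifold

variable {M : Type*} [TopologicalSpace M] [ChartedSpace E6 M] [IsManifold (𝓡 6) ∞ M]
variable {L : Type*} [LieRing L] [LieAlgebra ℝ L]

/-- A global `C²` frame of `TM`, indexed by a Lie algebra `L`, whose brackets are those of `L`: for
each `v : L` there is a vector field `E_v`, linear in `v`, with `[E_v, E_w] = E_⁅v, w⁆`, and
`v ↦ E_v(x)` is an isomorphism onto the tangent space at each point `x`. -/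
structure IsInvariantFrame (E : ∀ x : M, L →ₗ[ℝ] TangentSpace (𝓡 6) x) : Prop where
  bijective : ∀ x, Function.Bijective (E x)
  isC2Field : ∀ v, IsC2Field fun x => E x v
  mlieBracket_eq : ∀ v w x,
    mlieBracket (𝓡 6) (fun y => E y v) (fun y => E y w) x = E x ⁅v, w⁆

namespace IsInvariantFrame
variable {E : ∀ x : M, L →ₗ[ℝ] TangentSpace (𝓡 6) x} (hE : IsInvariantFrame E)

/-- The isomorphism of `L` with the tangent space at `x` given by the frame. -/
def equiv (x : M) : L ≃ₗ[ℝ] TangentSpace (𝓡 6) x := LinearEquiv.ofBijective (E x) (hE.bijective x)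

@[simp] lemma equiv_apply (x : M) (v : L) : hE.equiv x v = E x v := rfl

/-- The basis of `L` that the frame at `x` carries to the standard basis of the tangent space,
which is `ℝ⁶` by definition. -/
def basis (x : M) : Basis (Fin 6) ℝ L :=
  (EuclideanSpace.basisFun (Fin 6) ℝ).toBasis.map (hE.equiv x).symm

/-- The components of the vector field `X` in the frame `E_{b 0}, …, E_{b 5}`. -/
def coeff (b : Basis (Fin 6) ℝ L) (X : ∀ x : M, TangentSpace (𝓡 6) x) (i : Fin 6) (x : M) : ℝ :=
  b.equivFun ((hE.equiv x).symm (X x)) i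

lemma eq_sum_coeff (b : Basis (Fin 6) ℝ L) (X : ∀ x : M, TangentSpace (𝓡 6) x) :
    X = ∑ i, hE.coeff b X i • fun x => E x (b i) := by
  ext1 x
  have : (hE.equiv x) ((hE.equiv x).symm (X x)) = X x := LinearEquiv.apply_symm_apply _ _
  rw [← b.sum_equivFun ((hE.equiv x).symm (X x)), map_sum] at this
  rw [← this, Finset.sum_apply]
  simp [coeff]

/-- The components of a `C²` field are `C²`: in a trivialization of `TM` they are obtained from it
by the inverse of the matrix of the frame. -/
lemma contMDiff_coeff (b : Basis (Fin 6) ℝ L) {X : ∀ x : M, TangentSpace (𝓡 6) x}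
    (hX : IsC2Field X) (i : Fin 6) : ContMDiff (𝓡 6) 𝓘(ℝ, ℝ) 2 (hE.coeff b X i) := by
  intro x₀
  have : ContMDiffVectorBundle 2 E6 (TangentSpace (𝓡 6) : M → Type _) (𝓡 6) := by
    have : IsManifold (𝓡 6) (((2 : ℕ∞) : ℕ∞ω) + 1) M :=
      .of_le (n := ∞) (by exact mod_cast le_top)
    exact (inferInstance : ContMDiffVectorBundle ((2 : ℕ∞) : ℕ∞ω) E6
      (TangentSpace (𝓡 6) : M → Type _) (𝓡 6))
  let e := trivializationAt E6 (TangentSpace (𝓡 6) : M → Type _) x₀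
  have hx₀ : x₀ ∈ e.baseSet := FiberBundle.mem_baseSet_trivializationAt' x₀
  have hsec : ∀ Y : ∀ x : M, TangentSpace (𝓡 6) x, IsC2Field Y →
      ContMDiffAt (𝓡 6) 𝓘(ℝ, E6) 2 (fun y => (e ⟨y, Y y⟩).2) x₀ := fun Y hY =>
    (e.contMDiffAt_section_iff hx₀).1 hY.contMDiffAt
  let A : M → ((Fin 6 → ℝ) →L[ℝ] E6) := fun y =>
    ∑ i, (ContinuousLinearMap.proj i : (Fin 6 → ℝ) →L[ℝ] ℝ).smulRight (e ⟨y, E y (b i)⟩).2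
  let T : ∀ y ∈ e.baseSet, (Fin 6 → ℝ) ≃L[ℝ] E6 := fun y hy =>
    (b.equivFun.symm.trans ((hE.equiv y).trans
      (e.continuousLinearEquivAt ℝ y hy).toLinearEquiv)).toContinuousLinearEquiv
  have hAT : ∀ y (hy : y ∈ e.baseSet), A y = (T y hy : (Fin 6 → ℝ) →L[ℝ] E6) := by
    intro y hy
    ext1 c
    simp [A, T, Basis.equivFun_symm_apply, map_sum]
  have hA : ContMDiffAt (𝓡 6) 𝓘(ℝ, (Fin 6 → ℝ) →L[ℝ] E6) 2 A x₀ := by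
    refine contMDiffAt_finsetSum fun i _ => ?_
    exact ((ContinuousLinearMap.smulRightL ℝ (Fin 6 → ℝ) E6
      (ContinuousLinearMap.proj i)).contDiff.contDiffAt.contMDiffAt).comp x₀
        (hsec _ (hE.isC2Field (b i)))
  have hinv : ContMDiffAt (𝓡 6) 𝓘(ℝ, E6 →L[ℝ] (Fin 6 → ℝ)) 2
      (fun y => (A y).inverse) x₀ := by
    have := contDiffAt_map_inverse (n := 2) (T x₀ hx₀)
    rw [← hAT] at this
    exact this.contMDiffAt.comp x₀ hA
  have h := hinv.clm_apply (hsec X hX)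
  have h' : ContMDiffAt (𝓡 6) 𝓘(ℝ, ℝ) 2
      (fun y => (A y).inverse (e ⟨y, X y⟩).2 i) x₀ :=
    ((ContinuousLinearMap.proj i : (Fin 6 → ℝ) →L[ℝ] ℝ).contDiff.contDiffAt.contMDiffAt).comp
      x₀ h
  refine h'.congr_of_eventuallyEq ?_
  filter_upwards [e.open_baseSet.mem_nhds hx₀] with y hy
  rw [hAT y hy, ContinuousLinearMap.inverse_equiv]
  have h1 : (T y hy) (fun i => hE.coeff b X i y) = (e ⟨y, X y⟩).2 := by
    have : b.equivFun.symm (fun i => hE.coeff b X i y) = (hE.equiv y).symm (X y) :=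
      LinearEquiv.symm_apply_apply _ _
    simp [T, this, -Basis.equivFun_symm_apply]
  rw [← h1]
  simp

lemma isC2Field_map {X : ∀ x : M, TangentSpace (𝓡 6) x} (hX : IsC2Field X) (J₀ : L →ₗ[ℝ] L) :
    IsC2Field fun x => E x (J₀ ((hE.equiv x).symm (X x))) := by
  intro x₀
  let b := hE.basis x₀
  have : (fun x => E x (J₀ ((hE.equiv x).symm (X x)))) =
      ∑ i, hE.coeff b X i • fun x => E x (J₀ (b i)) := by
    ext1 x
    have h := b.sum_equivFun ((hE.equiv x).symm (X x))
    rw [← h, map_sum, map_sum, Finset.sum_apply]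
    simp [coeff]
  rw [this]
  exact isC2Field_sum _ (fun i _ =>
    (hE.contMDiff_coeff b hX i).smul_section (hE.isC2Field _)) x₀

/-- The value of an invariant one-form `φ` on a vector field. -/
def formApply (φ : L →ₗ[ℝ] ℝ) (X : ∀ x : M, TangentSpace (𝓡 6) x) (x : M) : ℝ :=
  φ ((hE.equiv x).symm (X x))

lemma formApply_eq_sum (b : Basis (Fin 6) ℝ L) (φ : L →ₗ[ℝ] ℝ)
    (X : ∀ x : M, TangentSpace (𝓡 6) x) :
    hE.formApply φ X = ∑ i, φ (b i) • hE.coeff b X i := by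
  ext1 x
  have h := b.sum_equivFun ((hE.equiv x).symm (X x))
  rw [formApply, ← h, map_sum, Finset.sum_apply]
  simp [coeff, mul_comm]

lemma mdifferentiableAt_coeff (b : Basis (Fin 6) ℝ L) {X : ∀ x : M, TangentSpace (𝓡 6) x}
    (hX : IsC2Field X) (i : Fin 6) (x : M) :
    MDifferentiableAt (𝓡 6) 𝓘(ℝ, ℝ) (hE.coeff b X i) x :=
  (hE.contMDiff_coeff b hX i).contMDiffAt.mdifferentiableAt (by norm_num)

lemma mvfderiv_formApply (b : Basis (Fin 6) ℝ L) (φ : L →ₗ[ℝ] ℝ)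
    {X : ∀ x : M, TangentSpace (𝓡 6) x} (hX : IsC2Field X) (x : M) (u : TangentSpace (𝓡 6) x) :
    MDifferentiableAt (𝓡 6) 𝓘(ℝ, ℝ) (hE.formApply φ X) x ∧
    mvfderiv (𝓡 6) (hE.formApply φ X) x u =
      ∑ i, mvfderiv (𝓡 6) (hE.coeff b X i) x u * φ (b i) := by
  have hs : ∀ i, MDifferentiableAt (𝓡 6) 𝓘(ℝ, ℝ) (φ (b i) • hE.coeff b X i) x := fun i =>
    (mdifferentiableAt_const (c := φ (b i))).smul (hE.mdifferentiableAt_coeff b hX i x)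
  rw [hE.formApply_eq_sum b]
  refine ⟨MDifferentiableAt.sum fun i _ => hs i, ?_⟩
  rw [mvfderiv_finset_sum _ fun i _ => hs i]
  simp only [sum_apply]
  refine Finset.sum_congr rfl fun i _ => ?_
  have := congrArg (· u) (mvfderiv_smul (a := fun _ => φ (b i))
    (mdifferentiableAt_const (c := φ (b i))) (hE.mdifferentiableAt_coeff b hX i x))
  simp [mvfderiv_const] at this
  rw [mul_comm]
  exact this

/-- An invariant one-form `φ` that vanishes on brackets is closed:
`φ([X, Y]) = X(φ(Y)) - Y(φ(X))` for all `C²` fields, not only for those of the frame. -/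
lemma formApply_mlieBracket (b : Basis (Fin 6) ℝ L) (φ : L →ₗ[ℝ] ℝ) (hφ : ∀ v w : L, φ ⁅v, w⁆ = 0)
    {X Y : ∀ x : M, TangentSpace (𝓡 6) x} (hX : IsC2Field X) (hY : IsC2Field Y) (x : M) :
    hE.formApply φ (mlieBracket (𝓡 6) X Y) x =
      mvfderiv (𝓡 6) (hE.formApply φ Y) x (X x) - mvfderiv (𝓡 6) (hE.formApply φ X) x (Y x) := by
  have := isManifold_minSmoothness (M := M) 2
  have hE0 : ∀ i, φ ((hE.equiv x).symm (E x (b i))) = φ (b i) := fun i => by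
    rw [← hE.equiv_apply, LinearEquiv.symm_apply_apply]
  have key : ∀ Z W : ∀ x : M, TangentSpace (𝓡 6) x, IsC2Field W →
      φ ((hE.equiv x).symm (mlieBracket (𝓡 6) Z W x)) =
        mvfderiv (𝓡 6) (hE.formApply φ W) x (Z x) + ∑ i, hE.coeff b W i x *
          φ ((hE.equiv x).symm (mlieBracket (𝓡 6) Z (fun y => E y (b i)) x)) := fun Z W hW => by
    conv_lhs => rw [hE.eq_sum_coeff b W]
    have hs : ∀ i, IsDiffAt (hE.coeff b W i • fun y => E y (b i)) x := fun i =>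
      (hE.mdifferentiableAt_coeff b hW i x).smul_section ((hE.isC2Field (b i)).isDiffAt x)
    rw [mlieBracket_sum_right _ _ fun i _ => hs i, (hE.mvfderiv_formApply b φ hW x _).2,
      map_sum, map_sum, ← Finset.sum_add_distrib]
    refine Finset.sum_congr rfl fun i _ => ?_
    rw [mlieBracket_smul_right (hE.mdifferentiableAt_coeff b hW i x)
      ((hE.isC2Field (b i)).isDiffAt x)]
    simp [hE0]
  -- Swapping the bracket turns the frame field into the differentiated one, where `φ` kills the
  -- brackets of the frame.
  have key2 : ∀ i, φ ((hE.equiv x).symm (mlieBracket (𝓡 6) X (fun y => E y (b i)) x)) =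
      - mvfderiv (𝓡 6) (hE.formApply φ X) x (E x (b i)) := fun i => by
    rw [mlieBracket_swap_apply, map_neg, map_neg, key _ _ hX]
    have h0 : ∀ j, φ ((hE.equiv x).symm
        (mlieBracket (𝓡 6) (fun y => E y (b i)) (fun y => E y (b j)) x)) = 0 := fun j => by
      rw [hE.mlieBracket_eq, ← hE.equiv_apply, LinearEquiv.symm_apply_apply, hφ]
    simp [h0]
  have hYx : ∑ i, hE.coeff b Y i x • E x (b i) = Y x := by
    conv_rhs => rw [hE.eq_sum_coeff b Y]
    simp
  rw [formApply, key _ _ hY]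
  simp only [key2, mul_neg, Finset.sum_neg_distrib]
  conv_rhs => rw [← hYx]
  simp [sub_eq_add_neg]

/-- A connection with `∇_{E_v} E_w = φ(v) E_{Bw}`, where `φ` is closed, is flat: its connection form
is `φ ⊗ B`, with curvature `dφ ⊗ B + (φ ∧ φ) ⊗ B² = 0`. -/
theorem curvature_eq_zero {E : ∀ x : M, L →ₗ[ℝ] TangentSpace (𝓡 6) x} (hE : IsInvariantFrame E)
    (D : Connection M) (φ : L →ₗ[ℝ] ℝ) (hφ : ∀ v w : L, φ ⁅v, w⁆ = 0)
    (B : L →ₗ[ℝ] L) (hD : ∀ v w x, D (fun y => E y w) x (E x v) = φ v • E x (B w))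
    {X Y Z : ∀ x : M, TangentSpace (𝓡 6) x} (hX : IsC2Field X) (hY : IsC2Field Y)
    (hZ : IsC2Field Z) (x : M) : curvature D X Y Z x = 0 := by
  let b := hE.basis x
  have hφX : ∀ (W : ∀ x : M, TangentSpace (𝓡 6) x) y w,
      D (fun y => E y w) y (W y) = hE.formApply φ W y • E y (B w) := fun W y w => by
    have := hD ((hE.equiv y).symm (W y)) w y
    rwa [← hE.equiv_apply y ((hE.equiv y).symm (W y)), LinearEquiv.apply_symm_apply] at this
  have hsmul : ∀ (f : M → ℝ) (W : ∀ x : M, TangentSpace (𝓡 6) x) y w,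
      MDifferentiableAt (𝓡 6) 𝓘(ℝ, ℝ) f y → D (f • fun y => E y w) y (W y) =
      mvfderiv (𝓡 6) f y (W y) • E y w + (f y * hE.formApply φ W y) • E y (B w) :=
    fun f W y w hf => by
      rw [D.isCovariantDerivativeOn.leibniz ((hE.isC2Field w).isDiffAt y) hf]
      simp [hφX, mul_smul, add_comm]
  have hsum : ∀ (f : Fin 6 → M → ℝ) (W : ∀ x : M, TangentSpace (𝓡 6) x) y (w : Fin 6 → L),
      (∀ i, MDifferentiableAt (𝓡 6) 𝓘(ℝ, ℝ) (f i) y) →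
      D (∑ i, f i • fun y => E y (w i)) y (W y) =
      ∑ i, (mvfderiv (𝓡 6) (f i) y (W y) • E y (w i) +
        (f i y * hE.formApply φ W y) • E y (B (w i))) := fun f W y w hf => by
    rw [connection_sum D _ fun i _ => (hf i).smul_section ((hE.isC2Field (w i)).isDiffAt y)]
    simp only [sum_apply]
    exact Finset.sum_congr rfl fun i _ => hsmul (f i) W y (w i) (hf i)
  set c := hE.coeff b Z with hc
  have hcd := hE.mdifferentiableAt_coeff b hZ
  have h1 : ∀ W : ∀ x : M, TangentSpace (𝓡 6) x, (fun y => D Z y (W y)) =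
      (∑ i, (fun y => mvfderiv (𝓡 6) (c i) y (W y)) • fun y => E y (b i)) +
      ∑ i, (c i * hE.formApply φ W) • fun y => E y (B (b i)) := fun W => by
    ext1 y
    conv_lhs => rw [hE.eq_sum_coeff b Z]
    rw [hsum _ W y _ fun i => hcd i y, Finset.sum_add_distrib, Pi.add_apply, Finset.sum_apply,
      Finset.sum_apply]
    rfl
  have h2 : ∀ W V : ∀ x : M, TangentSpace (𝓡 6) x, IsC2Field W →
      D (fun y => D Z y (W y)) x (V x) =
      ∑ i, (mvfderiv (𝓡 6) (fun y => mvfderiv (𝓡 6) (c i) y (W y)) x (V x) • E x (b i) +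
        (mvfderiv (𝓡 6) (c i) x (W x) * hE.formApply φ V x) • E x (B (b i))) +
      ∑ i, ((c i x * mvfderiv (𝓡 6) (hE.formApply φ W) x (V x) +
          hE.formApply φ W x * mvfderiv (𝓡 6) (c i) x (V x)) • E x (B (b i)) +
        (c i x * hE.formApply φ W x * hE.formApply φ V x) • E x (B (B (b i)))) := fun W V hW => by
    have d1 : ∀ i, MDifferentiableAt (𝓡 6) 𝓘(ℝ, ℝ) (fun y => mvfderiv (𝓡 6) (c i) y (W y)) x :=
      fun i => mdifferentiableAt_mvfderiv_apply (hE.contMDiff_coeff b hZ i) hW x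
    have dW := (hE.mvfderiv_formApply b φ hW x 0).1
    have d2 : ∀ i, MDifferentiableAt (𝓡 6) 𝓘(ℝ, ℝ) (c i * hE.formApply φ W) x :=
      fun i => (hcd i x).mul dW
    rw [h1, D.isCovariantDerivativeOn.add
      (isDiffAt_sum _ fun i _ => (d1 i).smul_section ((hE.isC2Field _).isDiffAt x))
      (isDiffAt_sum _ fun i _ => (d2 i).smul_section ((hE.isC2Field _).isDiffAt x)),
      add_apply, hsum _ V x _ d1, hsum _ V x _ d2]
    have e : ∀ i, mvfderiv (𝓡 6) (c i * hE.formApply φ W) x (V x) =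
        c i x * mvfderiv (𝓡 6) (hE.formApply φ W) x (V x) +
          hE.formApply φ W x * mvfderiv (𝓡 6) (c i) x (V x) := fun i => by
      rw [mvfderiv_mul (hcd i x) dW]
      rfl
    simp only [e]
    rfl
  have h3 := hE.formApply_mlieBracket b φ hφ hX hY x
  have h4 : ∀ i, mvfderiv (𝓡 6) (c i) x (mlieBracket (𝓡 6) X Y x) = _ := fun i =>
    mvfderiv_mlieBracket hX hY (hE.isC2Field (b 0)) (x := x)
      (fun h => b.ne_zero 0 ((hE.bijective x).1 (h.trans (map_zero _).symm)))
      (hE.contMDiff_coeff b hZ i)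
  have h5 : D Z x (mlieBracket (𝓡 6) X Y x) = _ := congrFun (h1 (mlieBracket (𝓡 6) X Y)) x
  rw [curvature, h2 _ _ hY, h2 _ _ hX, h5]
  simp only [Pi.add_apply, Finset.sum_apply, Pi.smul_apply', Pi.mul_apply, h3, h4]
  simp only [← Finset.sum_add_distrib, ← Finset.sum_sub_distrib]
  refine Finset.sum_eq_zero fun i _ => ?_
  module

end IsInvariantFrame
end Frame

/-! ### The Chern connection in an invariant frame -/

section Chern
open VectorField HermitianManifold LieHermitian

/-- Uniqueness of the Chern connection, at the level of the Lie algebra: the difference `S` of two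
Hermitian connections whose torsions have no `(1,1)`-part vanishes. Complex linearity in `w` and the
torsion condition make `S v w` complex linear in `v`, and then skewness for `v` and `J₀ v` together
force `g₀ (S v w) (S v w) = 0`. -/
lemma eq_zero_of_skew_of_torsion {L : Type*} [AddCommGroup L] [Module ℝ L] {J₀ : L →ₗ[ℝ] L}
    (hJ₀ : ∀ X, J₀ (J₀ X) = -X) {g₀ : L →ₗ[ℝ] L →ₗ[ℝ] ℝ}
    (hpos : ∀ X, X ≠ 0 → 0 < g₀ X X) (hcompat : ∀ X Y, g₀ (J₀ X) (J₀ Y) = g₀ X Y)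
    (S : L → L → L) (hneg : ∀ v w, S (-v) w = -S v w)
    (hSJ : ∀ v w, S v (J₀ w) = J₀ (S v w))
    (hSg : ∀ v w u, g₀ (S v w) u + g₀ w (S v u) = 0)
    (hST : ∀ v w, S (J₀ v) (J₀ w) - S (J₀ w) (J₀ v) = -(S v w - S w v)) (v w : L) :
    S v w = 0 := by
  have hsymm : ∀ v w, S v w + J₀ (S (J₀ v) w) = S w v + J₀ (S (J₀ w) v) := fun v w => by
    have := hST v w
    rw [hSJ, hSJ] at this
    linear_combination (norm := module) this
  have hP : ∀ v w, S v w + J₀ (S (J₀ v) w) = 0 := fun v w => by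
    have h1 := hsymm (J₀ v) w
    have h2 := congrArg J₀ (hsymm v w)
    simp only [hJ₀, hneg, hSJ, map_add, map_neg] at h1 h2
    have h3 : (2 : ℝ) • (S (J₀ v) w - J₀ (S v w)) = 0 := by
      linear_combination (norm := module) h1 - h2
    have h4 := sub_eq_zero.1 ((smul_eq_zero.1 h3).resolve_left two_ne_zero)
    rw [h4, hJ₀, add_neg_cancel]
  have hC : ∀ v w, S (J₀ v) w = J₀ (S v w) := fun v w => by
    have := congrArg J₀ (hP v w)
    simp only [hJ₀, map_add, map_zero] at this
    linear_combination (norm := module) -this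
  have hJg : ∀ X Y, g₀ (J₀ X) Y = - g₀ X (J₀ Y) := fun X Y => by
    have := hcompat X (J₀ Y)
    rw [hJ₀, map_neg] at this
    linarith
  by_contra h
  have h1 := hSg v w (S v w)
  have h2 := hSg (J₀ v) w (J₀ (S v w))
  rw [hC, hC, hcompat, hSJ, hJ₀, map_neg] at h2
  have := hpos _ h
  linarith

/-- The invariant connection `∇_{E_v} E_w = φ(v) E_{Bw}` is flat and is the Chern connection of
`(J₀, g₀)`: `φ` is closed, `B` is complex linear (so `∇J = 0`) and skew (so `∇g = 0`), and the
torsion `φ(v) B w - φ(w) B v - ⁅v, w⁆` has no `(1,1)`-part. -/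
structure IsFlatChernForm {L : Type*} [LieRing L] [LieAlgebra ℝ L] (J₀ : L →ₗ[ℝ] L)
    (g₀ : L →ₗ[ℝ] L →ₗ[ℝ] ℝ) (φ : L →ₗ[ℝ] ℝ) (B : L →ₗ[ℝ] L) : Prop where
  closed : ∀ v w : L, φ ⁅v, w⁆ = 0
  comm : ∀ v, B (J₀ v) = J₀ (B v)
  skew : ∀ v w, g₀ (B v) w + g₀ v (B w) = 0
  torsion : ∀ v w, φ (J₀ v) • B (J₀ w) - φ (J₀ w) • B (J₀ v) - ⁅J₀ v, J₀ w⁆ =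
    -(φ v • B w - φ w • B v - ⁅v, w⁆)

variable {M : Type*} [TopologicalSpace M] [ChartedSpace E6 M] [IsManifold (𝓡 6) ∞ M]
variable {L : Type*} [LieRing L] [LieAlgebra ℝ L]

/-- The Chern connection is the invariant connection determined by a flat Chern form; it is compared
with that connection pointwise, on the fields of the frame only. -/
theorem IsInvariantFrame.chernConnection_apply {E : ∀ x : M, L →ₗ[ℝ] TangentSpace (𝓡 6) x}
    (hE : IsInvariantFrame E) {J₀ : L →ₗ[ℝ] L} (hJ₀ : IsComplexStructure J₀)
    {g₀ : L →ₗ[ℝ] L →ₗ[ℝ] ℝ} (hg₀ : IsHermitianMetric J₀ g₀)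
    {J : ∀ x : M, TangentSpace (𝓡 6) x →ₗ[ℝ] TangentSpace (𝓡 6) x}
    (hJ : ∀ x v, J x (E x v) = E x (J₀ v))
    {g : ∀ x : M, TangentSpace (𝓡 6) x →ₗ[ℝ] TangentSpace (𝓡 6) x →ₗ[ℝ] ℝ}
    (hg : ∀ x v w, g x (E x v) (E x w) = g₀ v w)
    {D : Connection M} (hD : IsChernConnection J g D) {φ : L →ₗ[ℝ] ℝ} {B : L →ₗ[ℝ] L}
    (hB : IsFlatChernForm J₀ g₀ φ B) (v w : L) (x : M) :
    D (fun y => E y w) x (E x v) = φ v • E x (B w) := by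
  let Γ : L → L → L := fun v w => (hE.equiv x).symm (D (fun y => E y w) x (E x v))
  have hΓ : ∀ v w, D (fun y => E y w) x (E x v) = E x (Γ v w) := fun v w =>
    ((hE.equiv x).apply_symm_apply _).symm
  have hd := fun w => (hE.isC2Field w).isDiffAt x
  have hinj := (hE.bijective x).1
  have hΓJ : ∀ v w, Γ v (J₀ w) = J₀ (Γ v w) := fun v w => hinj <| by
    rw [← hΓ, ← hJ, ← hΓ, ← hD.parallel _ x (hd w)]
    simp only [hJ]
  have hΓg : ∀ v w u, g₀ (Γ v w) u + g₀ w (Γ v u) = 0 := fun v w u => by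
    have := hD.metric _ _ x (hd w) (hd u) (E x v)
    simp only [hg, hΓ, mvfderiv_const] at this
    exact this.symm
  have hΓT : ∀ v w, Γ (J₀ v) (J₀ w) - Γ (J₀ w) (J₀ v) - ⁅J₀ v, J₀ w⁆ =
      -(Γ v w - Γ w v - ⁅v, w⁆) := fun v w => hinj <| by
    have t : ∀ v w, D.torsion x (E x v) (E x w) = E x (Γ v w - Γ w v - ⁅v, w⁆) := fun v w => by
      rw [D.torsion_apply (X := fun y => E y v) (Y := fun y => E y w) (hd v) (hd w), hΓ, hΓ,
        hE.mlieBracket_eq, map_sub, map_sub]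
    rw [← t, map_neg, ← t, ← hD.torsion, hJ, hJ]
  have h := eq_zero_of_skew_of_torsion hJ₀.sq hg₀.pos hg₀.compat (fun v w => Γ v w - φ v • B w)
    (fun v w => by simp [Γ]; abel) (fun v w => by simp [hΓJ, hB.comm])
    (fun v w u => by
      have h1 := hΓg v w u
      have h2 := hB.skew w u
      simp
      linear_combination h1 - φ v * h2)
    (fun v w => by
      have h1 := hΓT v w
      have h2 := hB.torsion v w
      linear_combination (norm := module) h1 - h2) v w
  rw [hΓ, sub_eq_zero.1 h, map_smul]

/-- If the Lie algebra data admit a flat Chern form, the Chern connection is flat, and a flat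
connection is trivially an instanton. -/
theorem IsInvariantFrame.flat_and_instanton {E : ∀ x : M, L →ₗ[ℝ] TangentSpace (𝓡 6) x}
    (hE : IsInvariantFrame E) {J₀ : L →ₗ[ℝ] L} (hJ₀ : IsComplexStructure J₀)
    {g₀ : L →ₗ[ℝ] L →ₗ[ℝ] ℝ} (hg₀ : IsHermitianMetric J₀ g₀)
    {J : ∀ x : M, TangentSpace (𝓡 6) x →ₗ[ℝ] TangentSpace (𝓡 6) x}
    (hJ : ∀ x v, J x (E x v) = E x (J₀ v))
    {g : ∀ x : M, TangentSpace (𝓡 6) x →ₗ[ℝ] TangentSpace (𝓡 6) x →ₗ[ℝ] ℝ}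
    (hg : ∀ x v w, g x (E x v) (E x w) = g₀ v w)
    {D : Connection M} (hD : IsChernConnection J g D) {φ : L →ₗ[ℝ] ℝ} {B : L →ₗ[ℝ] L}
    (hB : IsFlatChernForm J₀ g₀ φ B) :
    IsInstanton J g D ∧ IsFlat D := by
  have hflat : ∀ X Y Z : ∀ x : M, TangentSpace (𝓡 6) x, IsC2Field X → IsC2Field Y → IsC2Field Z →
      ∀ x, curvature D X Y Z x = 0 := fun X Y Z hX hY hZ x =>
    hE.curvature_eq_zero D φ hB.closed B
      (fun v w x => hE.chernConnection_apply hJ₀ hg₀ hJ hg hD hB v w x) hX hY hZ x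
  have hs : ∀ X : ∀ x : M, TangentSpace (𝓡 6) x, IsSmoothField X → IsC2Field X := fun X hX =>
    ContMDiff.of_le hX ENat.LEInfty.out
  have hJX : ∀ X : ∀ x : M, TangentSpace (𝓡 6) x, IsC2Field X → IsC2Field fun y => J y (X y) :=
    fun X hX => by
      convert hE.isC2Field_map hX J₀ using 2 with y
      rw [← hJ, ← hE.equiv_apply, LinearEquiv.apply_symm_apply]
  exact ⟨⟨fun X Y Z hX hY hZ x => by
      rw [hflat _ _ _ (hJX X (hs X hX)) (hJX Y (hs Y hY)) (hs Z hZ),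
        hflat _ _ _ (hs X hX) (hs Y hY) (hs Z hZ)],
    fun V Z hV hZ x => Finset.sum_eq_zero fun σ _ => by
      rw [hflat _ _ _ (hs _ (hV _)) (hs _ (hV _)) (hs Z hZ), smul_zero]⟩,
    fun X Y Z hX hY hZ x => hflat _ _ _ (hs X hX) (hs Y hY) (hs Z hZ) x⟩

end Chern

/-! ### The invariant frame of a quotient of a Lie group -/

section Quotient
open VectorField HermitianManifold HomogeneousSpace

variable {G : Type*} [TopologicalSpace G] [ChartedSpace E6 G] [Group G]
variable {M : Type*} [TopologicalSpace M] [ChartedSpace E6 M]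

lemma HomogeneousSpace.IsQuotientBy.isInvertible_mfderiv {Γ : Subgroup G} {p : G → M}
    (hp : IsQuotientBy Γ p) (a : G) :
    (mfderiv (𝓡 6) (𝓡 6) p a).IsInvertible :=
  ⟨hp.localDiffeo.mfderivToContinuousLinearEquiv (by simp) a,
    hp.localDiffeo.mfderivToContinuousLinearEquiv_coe (by simp) a⟩

variable [LieGroup (𝓡 6) ∞ G]

lemma mulInvariantVectorField_mul (a b : G) (v : GroupLieAlgebra (𝓡 6) G) :
    mulInvariantVectorField v (a * b) =
      mfderiv (𝓡 6) (𝓡 6) (a * ·) b (mulInvariantVectorField v b) := by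
  have h : (fun x : G => a * b * x) = (a * ·) ∘ (b * ·) := by
    ext x; simp [mul_assoc]
  have hd : ∀ c d : G, MDifferentiableAt (𝓡 6) (𝓡 6) (c * ·) d := fun c d =>
    (contMDiff_mul_left (I := 𝓡 6) (n := ∞)).contMDiffAt.mdifferentiableAt (by simp)
  have h2 : HasMFDerivAt (𝓡 6) (𝓡 6) (fun x : G => a * b * x) 1
      ((mfderiv (𝓡 6) (𝓡 6) (a * ·) (b * 1)).comp (mfderiv (𝓡 6) (𝓡 6) (b * ·) (1 : G))) := by
    rw [h]
    exact (hd a (b * 1)).hasMFDerivAt.comp 1 (hd b 1).hasMFDerivAt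
  have h3 := congrArg (fun T : E6 →L[ℝ] E6 => T v) h2.mfderiv
  have h4 := congrArg (fun c : G => (mfderiv (𝓡 6) (𝓡 6) (a * ·) c : E6 →L[ℝ] E6)
    (mfderiv (𝓡 6) (𝓡 6) (b * ·) (1 : G) v)) (mul_one b)
  exact h3.trans h4

lemma mfderiv_inv_mul_mulInvariantVectorField (a : G) (v : GroupLieAlgebra (𝓡 6) G) :
    (mfderiv (𝓡 6) (𝓡 6) (a⁻¹ * ·) a (mulInvariantVectorField v a) : E6) = v := by
  have h1 : (mulInvariantVectorField v (1 : G) : E6) = v := by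
    have h0 : (fun x : G => 1 * x) = id := by ext x; simp
    have h : HasMFDerivAt (𝓡 6) (𝓡 6) (fun x : G => 1 * x) 1
        (ContinuousLinearMap.id ℝ (TangentSpace (𝓡 6) (1 : G))) := by
      rw [h0]; exact hasMFDerivAt_id 1
    exact congrArg (fun T : E6 →L[ℝ] E6 => T v) h.mfderiv
  have h2 := congrArg (fun c : G => (mulInvariantVectorField v c : E6)) (inv_mul_cancel a)
  exact (mulInvariantVectorField_mul a⁻¹ a v).symm.trans (h2.trans h1)

namespace HomogeneousSpace.IsQuotientBy
variable {Γ : Subgroup G} {p : G → M}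

/-- Left translation by `Γ` preserves the left-invariant fields, so the pushed-forward vectors at
`p a` do not depend on the choice of `a` in its fibre. The two tangent vectors have different base points
as terms, hence the comparison in the model space `ℝ⁶`. -/
lemma frame_mul (hp : IsQuotientBy Γ p) (a γ : G) (hγ : γ ∈ Γ) (v : GroupLieAlgebra (𝓡 6) G) :
    (frame p (γ * a) v : E6) = frame p a v := by
  have hpd : ∀ c, MDifferentiableAt (𝓡 6) (𝓡 6) p c := fun c =>
    hp.localDiffeo.mdifferentiable (by simp) c
  have hd : ∀ c d : G, MDifferentiableAt (𝓡 6) (𝓡 6) (c * ·) d := fun c d =>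
    (contMDiff_mul_left (I := 𝓡 6) (n := ∞)).contMDiffAt.mdifferentiableAt (by simp)
  have h : p ∘ (γ * ·) = p := by
    ext b
    exact ((hp.fiber b (γ * b)).2 ⟨γ, hγ, rfl⟩).symm
  have h2 := (hpd (γ * a)).hasMFDerivAt.comp a (hd γ a).hasMFDerivAt
  have h3 := congrArg (fun T : E6 →L[ℝ] E6 => T (mulInvariantVectorField v a)) h2.mfderiv
  have h4 := congrArg (fun f : G → M =>
    (mfderiv (𝓡 6) (𝓡 6) f a : E6 →L[ℝ] E6) (mulInvariantVectorField v a)) h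
  have h5 := congrArg (fun u : E6 => (mfderiv (𝓡 6) (𝓡 6) p (γ * a) : E6 →L[ℝ] E6) u)
    (mulInvariantVectorField_mul γ a v)
  exact h5.trans (h3.symm.trans h4)

variable (hp : IsQuotientBy Γ p)

/-- The vector fields on `Γ\G` induced by the left-invariant fields on `G`: the value at `x` is the
push-forward from an arbitrary chosen point of the fibre over `x`. -/
def quotientFrame (x : M) : GroupLieAlgebra (𝓡 6) G →ₗ[ℝ] TangentSpace (𝓡 6) x :=
  let a := (hp.surjective x).choose
  ((mfderiv (𝓡 6) (𝓡 6) p a) ∘L (mfderiv (𝓡 6) (𝓡 6) (a * ·) (1 : G))).toLinearMap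

lemma quotientFrame_apply (a : G) (v : GroupLieAlgebra (𝓡 6) G) :
    hp.quotientFrame (p a) v = frame p a v := by
  obtain ⟨γ, hγ, h⟩ := (hp.fiber a _).1 (hp.surjective (p a)).choose_spec.symm
  have h2 := hp.frame_mul a γ hγ v
  rw [← h] at h2
  exact h2

lemma mpullback_quotientFrame (v : GroupLieAlgebra (𝓡 6) G) :
    mpullback (𝓡 6) (𝓡 6) p (fun x => hp.quotientFrame x v) = mulInvariantVectorField v := by
  ext1 a
  rw [mpullback_apply, quotientFrame_apply, frame]
  obtain ⟨T, hT⟩ := hp.isInvertible_mfderiv a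
  rw [← hT, ContinuousLinearMap.inverse_equiv]
  simp

variable [IsManifold (𝓡 6) ∞ M]

/-- Locally the induced field is the push-forward of a left-invariant field by a local inverse
of `p`. -/
lemma isC2Field_quotientFrame (v : GroupLieAlgebra (𝓡 6) G) :
    IsC2Field fun x => hp.quotientFrame x v := by
  intro x
  obtain ⟨a, rfl⟩ := hp.surjective x
  have hq := (hp.localDiffeo a).localInverse_contMDiffAt
  have h0 : (hp.localDiffeo a).localInverse (p a) = a := by
    exact (hp.localDiffeo a).localInverse_left_inv (hp.localDiffeo a).localInverse_mem_target
  have hm : minSmoothness ℝ 2 = 2 := minSmoothness_of_isRCLikeNormedField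
  have h1 : ContMDiff (𝓡 6) (𝓡 6).tangent 2
      (fun b : G => (mulInvariantVectorField v b : TangentBundle (𝓡 6) G)) := by
    rw [← hm]; exact contMDiff_mulInvariantVectorField v
  have h2 : ContMDiff (𝓡 6).tangent (𝓡 6).tangent 2 (tangentMap (𝓡 6) (𝓡 6) p) :=
    hp.localDiffeo.contMDiff.contMDiff_tangentMap
      (by rw [two_add_one_eq_three]; exact ENat.LEInfty.out)
  have h3 := (h2.comp h1).contMDiffAt.comp (p a) (hq.of_le ENat.LEInfty.out)
  refine h3.congr_of_eventuallyEq ?_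
  filter_upwards [(hp.localDiffeo a).localInverse_eventuallyEq_right] with y hy
  have h4 : p ((hp.localDiffeo a).localInverse y) = y := hy
  have h5 := hp.quotientFrame_apply ((hp.localDiffeo a).localInverse y) v
  have h6 : (⟨y, hp.quotientFrame y v⟩ : TangentBundle (𝓡 6) M) =
      ⟨p ((hp.localDiffeo a).localInverse y),
        hp.quotientFrame (p ((hp.localDiffeo a).localInverse y)) v⟩ := by rw [h4]
  rw [h6, h5]
  rfl

lemma isInvariantFrame_quotientFrame : IsInvariantFrame hp.quotientFrame where
  bijective x := by
    obtain ⟨a, rfl⟩ := hp.surjective x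
    obtain ⟨T, hT⟩ := hp.isInvertible_mfderiv a
    have h1 : ∀ v, hp.quotientFrame (p a) v = T (mulInvariantVectorField v a) := fun v => by
      rw [quotientFrame_apply, frame, ← hT]; rfl
    have hinj : Function.Injective (hp.quotientFrame (p a)) := fun v w h => by
      rw [h1, h1] at h
      have h2 := T.injective h
      rw [← mfderiv_inv_mul_mulInvariantVectorField a v,
        ← mfderiv_inv_mul_mulInvariantVectorField a w, h2]
    let f : E6 →ₗ[ℝ] E6 := hp.quotientFrame (p a)
    have hf : Function.Surjective f := LinearMap.injective_iff_surjective.1 hinj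
    exact ⟨hinj, hf⟩
  isC2Field := hp.isC2Field_quotientFrame
  mlieBracket_eq v w x := by
    obtain ⟨a, rfl⟩ := hp.surjective x
    have := isManifold_minSmoothness (M := M) 2
    have hb := mulInvariantVector_mlieBracket (I := 𝓡 6) v w
    have hd : ∀ u, MDifferentiableAt (𝓡 6) (𝓡 6).tangent
        (fun y => (⟨y, hp.quotientFrame y u⟩ : TangentBundle (𝓡 6) M)) (p a) := fun u =>
      (hp.isC2Field_quotientFrame u).isDiffAt (p a)
    have hm : minSmoothness ℝ 2 = 2 := minSmoothness_of_isRCLikeNormedField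
    have h := mpullback_mlieBracket (I := 𝓡 6) (I' := 𝓡 6) (𝕜 := ℝ) (n := ∞) (x₀ := a) (hd v) (hd w)
      hp.localDiffeo.contMDiff.contMDiffAt (by rw [hm]; exact ENat.LEInfty.out)
    rw [mpullback_quotientFrame, mpullback_quotientFrame, ← hb, mpullback_apply] at h
    obtain ⟨T, hT⟩ := hp.isInvertible_mfderiv a
    rw [quotientFrame_apply, frame, GroupLieAlgebra.bracket_def, ← h, ← hT,
      ContinuousLinearMap.inverse_equiv]
    simp

end HomogeneousSpace.IsQuotientBy
end Quotient

/-! ### Complex Lie algebras and diagonal metrics -/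

section Algebra
open LieForms LieHermitian SixDim

variable {L : Type*} [LieRing L] [LieAlgebra ℝ L]

/-- The basis dual to a coframe. -/
lemma exists_dual_basis [FiniteDimensional ℝ L] (e : Basis (Fin 6) ℝ (L →ₗ[ℝ] ℝ)) :
    ∃ b : Basis (Fin 6) ℝ L, ∀ i x, b.repr x i = e i x := by
  let b := e.dualBasis.map (evalEquiv ℝ L).symm
  have hb : ∀ i j, e i (b j) = if i = j then 1 else 0 := fun i j => by
    have : evalEquiv ℝ L (b j) = e.dualBasis j := by simp [b]
    have h2 := congrArg (fun f => f (e i)) this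
    simpa [Finsupp.single_apply] using h2
  refine ⟨b, fun i x => ?_⟩
  conv_rhs => rw [← b.sum_repr x]
  simp only [map_sum, map_smul, hb]
  simp

/-- For a complex Lie algebra the trivial connection `∇E_v = 0` is the Chern connection, as its
torsion `-⁅v, w⁆` is complex bilinear. -/
lemma isFlatChernForm_zero {J₀ : L →ₗ[ℝ] L} (hJ₀ : IsComplexStructure J₀)
    (hP : IsComplexParallelizable J₀) (g₀ : L →ₗ[ℝ] L →ₗ[ℝ] ℝ) :
    IsFlatChernForm J₀ g₀ 0 0 where
  closed _ _ := rfl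
  comm _ := by simp
  skew _ _ := by simp
  torsion v w := by
    have : ⁅J₀ v, J₀ w⁆ = -⁅v, w⁆ := by
      rw [hP, ← lie_skew, hP, map_neg, hJ₀.sq, neg_neg, lie_skew]
    simp [this]

/-- For a diagonal metric, `B` is the endomorphism with eigenvalues `i, -i, 0` in the basis dual to
`η⁰, η¹, η²`, which is skew since that basis is orthogonal, and `φ = 2 Im (M η̄²)`. With this choice
the `(1,1)`-part `M η⁰ ∧ η̄²` of `dη⁰` is cancelled by the connection form. -/
lemma exists_isFlatChernForm_of_isDiagonal (hL : finrank ℝ L = 6) {J₀ : L →ₗ[ℝ] L}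
    {g₀ : L →ₗ[ℝ] L →ₗ[ℝ] ℝ} (hg₀ : IsHermitianMetric J₀ g₀) (hd : IsDiagonal J₀ g₀) :
    ∃ φ B, IsFlatChernForm J₀ g₀ φ B := by
  obtain ⟨η, K, M, r, -, hηJ, h0, h1, h2, hr, hF⟩ := hd
  have : FiniteDimensional ℝ L := FiniteDimensional.of_finrank_eq_succ hL
  -- The metric is recovered as `g₀ X Y = F X (J₀ Y)`.
  have hg : ∀ X Y, 2 * (g₀ X Y : ℂ) = ∑ k, (r k : ℂ) ^ 2 *
      (η k X * (starRingEnd ℂ) (η k Y) + η k Y * (starRingEnd ℂ) (η k X)) := fun X Y => by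
    have h := hF X (J₀ Y)
    rw [fundForm, hg₀.compat] at h
    rw [h, Finset.mul_sum]
    refine Finset.sum_congr rfl fun k _ => ?_
    simp only [wedge, conjForm, LinearMap.comp_apply, AlgEquiv.toLinearMap_apply,
      Complex.conjAe_coe, hηJ, map_mul, Complex.conj_I]
    linear_combination (-(r k : ℂ) ^ 2 * (η k X * (starRingEnd ℂ) (η k Y) +
      η k Y * (starRingEnd ℂ) (η k X))) * Complex.I_sq
  -- The `η k` are real coordinates: a vector they all kill has length zero.
  let Φ : L →ₗ[ℝ] (Fin 3 → ℂ) := LinearMap.pi η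
  have hinj : Function.Injective Φ := (injective_iff_map_eq_zero Φ).2 fun X hX => by
    by_contra hne
    have h := hg X X
    have : ∀ k, η k X = 0 := fun k => congrFun hX k
    simp only [this] at h
    have := hg₀.pos X hne
    simp at h
    linarith
  let e : L ≃ₗ[ℝ] (Fin 3 → ℂ) := LinearEquiv.ofInjectiveOfFinrankEq Φ hinj (by
    rw [hL]; simp [Module.finrank_pi_fintype])
  have he : ∀ X k, e X k = η k X := fun X k => rfl
  have hext : ∀ X Y, (∀ k, η k X = η k Y) → X = Y := fun X Y h =>
    e.injective (funext fun k => h k)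
  let d : Fin 3 → ℂ := ![Complex.I, -Complex.I, 0]
  let T : (Fin 3 → ℂ) →ₗ[ℝ] (Fin 3 → ℂ) :=
    { toFun := fun z k => d k * z k
      map_add' := fun _ _ => by ext; simp [mul_add]
      map_smul' := fun _ _ => by ext; simp; ring }
  let B : L →ₗ[ℝ] L := e.symm.toLinearMap ∘ₗ T ∘ₗ e.toLinearMap
  have hB : ∀ X k, η k (B X) = d k * η k X := fun X k => by
    rw [← he, ← he]; simp [B, T]
  let φ : L →ₗ[ℝ] ℝ := Complex.imLm ∘ₗ ((2 * M) • conjForm (η 2))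
  have hφ : ∀ X, (φ X : ℂ) * Complex.I =
      M * (starRingEnd ℂ) (η 2 X) - (starRingEnd ℂ) M * η 2 X := fun X => by
    apply Complex.ext <;> simp [φ, conjForm]
    ring
  have hb : ∀ k v w, η k ⁅v, w⁆ = - dOne (η k) v w := fun k v w => by simp [dOne]
  refine ⟨φ, B, ⟨fun v w => ?_, fun v => hext _ _ fun k => ?_, fun v w => ?_,
    fun v w => hext _ _ fun k => ?_⟩⟩
  · have : η 2 ⁅v, w⁆ = 0 := by rw [hb, h2]; simp
    simp [φ, conjForm, this]
  · simp only [hB, hηJ]; ring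
  · have h1 := hg (B v) w
    have h2 := hg v (B w)
    have : (2 : ℂ) * ((g₀ (B v) w + g₀ v (B w) : ℝ) : ℂ) = 0 := by
      push_cast
      rw [mul_add, h1, h2]
      simp only [Fin.sum_univ_three, hB]
      simp [d]
      ring
    have := (mul_eq_zero.1 this).resolve_left two_ne_zero
    exact_mod_cast this
  · have hs : ∀ (a : ℝ) X, η k (a • X) = a * η k X := fun a X => by simp
    simp only [map_sub, map_neg, hs, hB, hηJ, hb]
    have f1 := hφ v
    have f2 := hφ w
    have f3 := hφ (J₀ v)
    have f4 := hφ (J₀ w)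
    simp only [hηJ, map_mul, Complex.conj_I] at f3 f4
    have hI := Complex.I_sq
    fin_cases k
    · simp [d, h0, wedge, conjForm, hηJ]
      linear_combination Complex.I * η 0 w * f3 - Complex.I * η 0 v * f4 + η 0 w * f1 - η 0 v * f2
        + (K * (η 0 v * η 2 w - η 0 w * η 2 v)
          - M * (η 0 v * (starRingEnd ℂ) (η 2 w) - η 0 w * (starRingEnd ℂ) (η 2 v))
          + (η 0 w * (-M * (starRingEnd ℂ) (η 2 v) - (starRingEnd ℂ) M * η 2 v)
            - η 0 v * (-M * (starRingEnd ℂ) (η 2 w) - (starRingEnd ℂ) M * η 2 w))) * hI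
    · simp [d, h1, wedge, conjForm, hηJ]
      linear_combination -Complex.I * η 1 w * f3 + Complex.I * η 1 v * f4 - η 1 w * f1 + η 1 v * f2
        - (K * (η 1 v * η 2 w - η 1 w * η 2 v)
          - M * (η 1 v * (starRingEnd ℂ) (η 2 w) - η 1 w * (starRingEnd ℂ) (η 2 v))
          + (η 1 w * (-M * (starRingEnd ℂ) (η 2 v) - (starRingEnd ℂ) M * η 2 v)
            - η 1 v * (-M * (starRingEnd ℂ) (η 2 w) - (starRingEnd ℂ) M * η 2 w))) * hI
    · simp [d, h2]

end Algebra

/-! ### Kähler metrics -/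

section Kahler
open LieForms LieHermitian SixDim

variable {L : Type*} [LieRing L] [LieAlgebra ℝ L]

lemma LieHermitian.IsKahler.apply {J₀ : L →ₗ[ℝ] L} {g₀ : L →ₗ[ℝ] L →ₗ[ℝ] ℝ}
    (hK : IsKahler J₀ g₀) (X Y Z : L) :
    g₀ (J₀ ⁅X, Y⁆) Z - g₀ (J₀ ⁅X, Z⁆) Y + g₀ (J₀ ⁅Y, Z⁆) X = 0 := by
  have h := congrFun hK ![X, Y, Z]
  simp [ceD, fundForm, Fin.sum_univ_three, Fin.sum_univ_two, Fin.succAbove] at h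
  linarith

/-- A Kähler metric on the semidirect product of `ℝ t` with the abelian ideal `ker τ`, where `t` acts
by `A`, with `A² = -1` modulo the central vector `Z`. Kählerness makes `A` preserve `F` on the
ideal. Hence `T = J₀ Z` is orthogonal to the ideal, and `B = ad T`, which commutes with `J₀` since
`Z = -J₀ T` is central, is skew. With `φ = τ / τ(T)` the torsion even vanishes, that is, `φ ⊗ B` is
the Levi-Civita connection. -/
lemma exists_isFlatChernForm_of_isKahler {J₀ : L →ₗ[ℝ] L} (hJ₀ : IsComplexStructure J₀)
    {g₀ : L →ₗ[ℝ] L →ₗ[ℝ] ℝ} (hg₀ : IsHermitianMetric J₀ g₀) (hK : IsKahler J₀ g₀)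
    {A : L →ₗ[ℝ] L} {τ ε : L →ₗ[ℝ] ℝ} {t Z : L}
    (hbr : ∀ X Y : L, ⁅X, Y⁆ = τ X • A Y - τ Y • A X)
    (hτA : ∀ X, τ (A X) = 0) (hAZ : A Z = 0) (hAt : A t = 0) (hτt : τ t = 1)
    (hτZ : τ Z = 0) (hZ : Z ≠ 0) (hAA : ∀ X, τ X = 0 → A (A X) = -X + ε X • Z) :
    ∃ φ B, IsFlatChernForm J₀ g₀ φ B := by
  have hJg : ∀ X Y, g₀ (J₀ X) Y = - g₀ X (J₀ Y) := fun X Y => by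
    have := hg₀.compat X (J₀ Y)
    rw [hJ₀.sq, map_neg] at this
    linarith
  have hAF : ∀ X Y, τ X = 0 → τ Y = 0 → g₀ (J₀ (A X)) Y + g₀ (J₀ X) (A Y) = 0 :=
    fun X Y hX hY => by
      have h := hK.apply X Y t
      simp only [hbr, hX, hY, hτt, hAt, zero_smul, smul_zero, one_smul, zero_sub, sub_self,
        map_zero, LinearMap.zero_apply, map_neg, LinearMap.neg_apply] at h
      rw [hJg X, hg₀.symm X]
      linarith
  have hFZ : ∀ X, τ X = 0 → g₀ (J₀ X) Z = 0 := fun X hX => by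
    have h := hAF (A X) Z (hτA X) hτZ
    have hZZ : g₀ (J₀ Z) Z = 0 := by
      have := hJg Z Z
      rw [hg₀.symm Z] at this
      linarith
    rw [hAA X hX, hAZ] at h
    simpa [hZZ] using h
  set T := J₀ Z with hT
  have hJT : J₀ T = -Z := hJ₀.sq Z
  have hgT : ∀ X, τ X = 0 → g₀ X T = 0 := fun X hX => by
    have := hJg X Z
    rw [hFZ X hX] at this
    linarith
  have hZZ := hg₀.pos Z hZ
  have hTT : 0 < g₀ T T := by rw [hT, hg₀.compat]; exact hZZ
  have hτT : τ T ≠ 0 := fun h => hTT.ne' (hgT T h)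
  let B : L →ₗ[ℝ] L := (LieModule.toEnd ℝ L L T : L →ₗ[ℝ] L)
  have hB : ∀ X, B X = τ T • A X - τ X • A T := fun X => by simp [B, hbr]
  have hτB : ∀ X, τ (B X) = 0 := fun X => by simp [hB, hτA]
  have hBT : B T = 0 := by rw [hB, sub_self]
  have hBZ : B Z = 0 := by rw [hB, hAZ, hτZ, smul_zero, zero_smul, sub_self]
  have hBh : ∀ X, τ X = 0 → B X = τ T • A X := fun X hX => by
    rw [hB, hX, zero_smul, sub_zero]
  have hBJ : ∀ X, B (J₀ X) = J₀ (B X) := fun X => by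
    have h := hJ₀.nijenhuis Z X
    have hz : ∀ Y : L, ⁅Z, Y⁆ = 0 := fun Y => by simp [hbr, hτZ, hAZ]
    rw [hz, hz, map_zero, sub_zero, sub_zero] at h
    exact sub_eq_zero.1 h
  have hsT : ∀ X, g₀ (B X) T = 0 := fun X => hgT _ (hτB X)
  have hsZ : ∀ X, g₀ (B X) Z = 0 := fun X => by
    rw [← hg₀.compat, ← hBJ]
    exact hsT _
  -- For `X` orthogonal to `Z`, the vector `J₀ X` is orthogonal to `T` and so lies in the ideal,
  -- where `B` is a multiple of `A` and preserves the fundamental form.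
  have h1 : ∀ X Y, g₀ X Z = 0 → τ Y = 0 → g₀ (B X) Y + g₀ X (B Y) = 0 := fun X Y hX hY => by
    have hτ : τ (J₀ X) = 0 := by
      have h0 : τ (J₀ X - (τ (J₀ X) / τ T) • T) = 0 := by
        rw [map_sub, map_smul, smul_eq_mul, div_mul_cancel₀ _ hτT, sub_self]
      have h1 := hgT _ h0
      rw [map_sub, LinearMap.sub_apply, map_smul, LinearMap.smul_apply, hT, hg₀.compat, hX,
        ← hT, smul_eq_mul, zero_sub, neg_eq_zero, mul_eq_zero] at h1
      exact (div_eq_zero_iff.1 (h1.resolve_right hTT.ne')).resolve_right hτT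
    have h2 := hAF (J₀ X) Y hτ hY
    have h4 : g₀ (J₀ (B (J₀ X))) Y + g₀ (J₀ (J₀ X)) (B Y) = 0 := by
      rw [hBh _ hτ, hBh _ hY]
      simp only [map_smul, LinearMap.smul_apply, smul_eq_mul]
      linear_combination τ T * h2
    rw [← hBJ, hJ₀.sq] at h4
    simp only [map_neg, LinearMap.neg_apply] at h4
    linarith
  refine ⟨(τ T)⁻¹ • τ, B, ⟨fun X Y => ?_, hBJ, fun X Y => ?_, ?_⟩⟩
  · simp [hbr, hτA]
  · have hX : g₀ (X - (g₀ X Z / g₀ Z Z) • Z) Z = 0 := by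
      rw [map_sub, LinearMap.sub_apply, map_smul, LinearMap.smul_apply, smul_eq_mul,
        div_mul_cancel₀ _ hZZ.ne', sub_self]
    have hY : τ (Y - (τ Y / τ T) • T) = 0 := by
      rw [map_sub, map_smul, smul_eq_mul, div_mul_cancel₀ _ hτT, sub_self]
    have h := h1 _ _ hX hY
    simp only [map_sub, map_smul, hBT, hBZ, smul_zero, sub_zero, LinearMap.sub_apply,
      LinearMap.smul_apply, hsT, smul_eq_mul, mul_zero] at h
    rw [hg₀.symm Z (B Y), hsZ, mul_zero, sub_zero] at h
    exact h
  · have h0 : ∀ X Y : L, ((τ T)⁻¹ • τ) X • B Y - ((τ T)⁻¹ • τ) Y • B X - ⁅X, Y⁆ = 0 :=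
      fun X Y => by
        rw [hB, hB, hbr]
        simp only [LinearMap.smul_apply, smul_eq_mul, smul_sub, smul_smul]
        have e1 : ∀ a, (τ T)⁻¹ * a * τ T = a := fun a => by field_simp
        rw [e1, e1, mul_right_comm _ (τ Y) (τ X)]
        abel
    intro X Y
    rw [h0, h0, neg_zero]

/-- In the dual basis `b`, the algebra `𝔤₂⁰` is the semidirect product of `ℝ b₄` with the span of the
other vectors, on which `ad b₄` is a complex structure modulo the central vector `b₅`. -/
lemma exists_isFlatChernForm_of_isG2_zero [FiniteDimensional ℝ L] {J₀ : L →ₗ[ℝ] L}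
    (hJ₀ : IsComplexStructure J₀) {g₀ : L →ₗ[ℝ] L →ₗ[ℝ] ℝ} (hg₀ : IsHermitianMetric J₀ g₀)
    (hK : IsKahler J₀ g₀) (hL : IsG2 L 0) : ∃ φ B, IsFlatChernForm J₀ g₀ φ B := by
  obtain ⟨e, h0, h1, h2, h3, h4, h5⟩ := hL
  obtain ⟨b, hb⟩ := exists_dual_basis e
  have hext : ∀ X Y : L, (∀ i, e i X = e i Y) → X = Y := fun X Y h =>
    b.repr.injective (Finsupp.ext fun i => by rw [hb, hb, h])
  have hbb : ∀ i j, e i (b j) = if j = i then 1 else 0 := fun i j => by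
    rw [← hb, b.repr_self, Finsupp.single_apply]
  have hd : ∀ i (X Y : L), e i ⁅X, Y⁆ = -dOne (e i) X Y := fun i X Y => by simp [dOne]
  let A : L →ₗ[ℝ] L := LieModule.toEnd ℝ L L (b 4)
  have hA : ∀ i X, e i (A X) = -dOne (e i) (b 4) X := fun i X => hd i _ _
  have hA0 : ∀ X, e 0 (A X) = e 1 X := fun X => by simp [hA, h0, wedge, hbb]
  have hA1 : ∀ X, e 1 (A X) = -e 0 X := fun X => by simp [hA, h1, wedge, hbb]
  have hA2 : ∀ X, e 2 (A X) = e 3 X := fun X => by simp [hA, h2, wedge, hbb]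
  have hA3 : ∀ X, e 3 (A X) = -e 2 X := fun X => by simp [hA, h3, wedge, hbb]
  have hA4 : ∀ X, e 4 (A X) = 0 := fun X => by simp [hA, h4]
  have hA5 : ∀ X, e 5 (A X) = 0 := fun X => by simp [hA, h5]
  refine exists_isFlatChernForm_of_isKahler hJ₀ hg₀ hK (A := A) (τ := e 4) (ε := e 5) (t := b 4)
    (Z := b 5) (fun X Y => hext _ _ fun i => ?_) hA4 (hext _ _ fun i => ?_)
    (hext _ _ fun i => ?_) (by simp [hbb]) (by simp [hbb]) (b.ne_zero 5)
    (fun X hX => hext _ _ fun i => ?_)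
  · fin_cases i <;> simp [hd, h0, h1, h2, h3, h4, h5, hA0, hA1, hA2, hA3, hA4, hA5, wedge] <;> ring
  · fin_cases i <;> simp [hA0, hA1, hA2, hA3, hA4, hA5, hbb]
  · fin_cases i <;> simp [hA0, hA1, hA2, hA3, hA4, hA5, hbb]
  · fin_cases i <;> simp [hA0, hA1, hA2, hA3, hA4, hA5, hbb, hX]

end Kahler

/-! ### The differential of the squared fundamental form -/

section Balanced
open LieForms LieHermitian

variable {L : Type*} [LieRing L]

/-- The Chevalley–Eilenberg differential of a four-form, written out. -/
lemma ceD_fourForm (q : L → L → L → L → ℝ) (X : Fin 5 → L) :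
    ceD (fun v => q (v 0) (v 1) (v 2) (v 3)) X =
      -q ⁅X 0, X 1⁆ (X 2) (X 3) (X 4) + q ⁅X 0, X 2⁆ (X 1) (X 3) (X 4)
      - q ⁅X 0, X 3⁆ (X 1) (X 2) (X 4) + q ⁅X 0, X 4⁆ (X 1) (X 2) (X 3)
      - q ⁅X 1, X 2⁆ (X 0) (X 3) (X 4) + q ⁅X 1, X 3⁆ (X 0) (X 2) (X 4)
      - q ⁅X 1, X 4⁆ (X 0) (X 2) (X 3) - q ⁅X 2, X 3⁆ (X 0) (X 1) (X 4)
      + q ⁅X 2, X 4⁆ (X 0) (X 1) (X 3) - q ⁅X 3, X 4⁆ (X 0) (X 1) (X 2) := by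
  change (∑ j : Fin 5, ∑ i : Fin 4, if i.castSucc < j then (-1 : ℝ) ^ ((i : ℕ) + (j : ℕ)) *
    q ⁅X i.castSucc, X j⁆ (X (j.succAbove (i.succAbove 0))) (X (j.succAbove (i.succAbove 1)))
        (X (j.succAbove (i.succAbove 2))) else 0) = _
  simp [Fin.sum_univ_five, Fin.sum_univ_four, Fin.succAbove]
  ring

variable [LieAlgebra ℝ L]

/-- `F ∧ F` as a function of four arguments. -/
def fundFormSqApply (J₀ : L →ₗ[ℝ] L) (g₀ : L →ₗ[ℝ] L →ₗ[ℝ] ℝ) (a b c d : L) : ℝ :=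
  2 * (fundForm J₀ g₀ a b * fundForm J₀ g₀ c d - fundForm J₀ g₀ a c * fundForm J₀ g₀ b d
    + fundForm J₀ g₀ a d * fundForm J₀ g₀ b c)

lemma ceD_fundFormSq {J₀ : L →ₗ[ℝ] L} {g₀ : L →ₗ[ℝ] L →ₗ[ℝ] ℝ} {q : L → L → L → L → ℝ}
    (hq : q = fundFormSqApply J₀ g₀) (X : Fin 5 → L) : ceD (fundFormSq J₀ g₀) X =
      -q ⁅X 0, X 1⁆ (X 2) (X 3) (X 4) + q ⁅X 0, X 2⁆ (X 1) (X 3) (X 4)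
      - q ⁅X 0, X 3⁆ (X 1) (X 2) (X 4) + q ⁅X 0, X 4⁆ (X 1) (X 2) (X 3)
      - q ⁅X 1, X 2⁆ (X 0) (X 3) (X 4) + q ⁅X 1, X 3⁆ (X 0) (X 2) (X 4)
      - q ⁅X 1, X 4⁆ (X 0) (X 2) (X 3) - q ⁅X 2, X 3⁆ (X 0) (X 1) (X 4)
      + q ⁅X 2, X 4⁆ (X 0) (X 1) (X 3) - q ⁅X 3, X 4⁆ (X 0) (X 1) (X 2) := by
  subst hq
  exact ceD_fourForm (fundFormSqApply J₀ g₀) X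

lemma fundForm_swap {J₀ : L →ₗ[ℝ] L} (hJ₀ : IsComplexStructure J₀)
    {g₀ : L →ₗ[ℝ] L →ₗ[ℝ] ℝ} (hg₀ : IsHermitianMetric J₀ g₀) (X Y : L) :
    fundForm J₀ g₀ X Y = -fundForm J₀ g₀ Y X := by
  have := hg₀.compat X (J₀ Y)
  rw [hJ₀.sq, map_neg] at this
  rw [fundForm, fundForm, hg₀.symm (J₀ Y)]
  linarith

/-- `d(F ∧ F)`, bundled as an alternating map so that it can be evaluated on a basis. -/
def dFundFormSq {J₀ : L →ₗ[ℝ] L} (hJ₀ : IsComplexStructure J₀)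
    {g₀ : L →ₗ[ℝ] L →ₗ[ℝ] ℝ} (hg₀ : IsHermitianMetric J₀ g₀) : L [⋀^Fin 5]→ₗ[ℝ] ℝ where
  toFun := ceD (fundFormSq J₀ g₀)
  map_update_add' := by
    intro inst X i x y
    obtain rfl : inst = instDecidableEqFin 5 := Subsingleton.elim _ _
    have hadd : ∀ a b c, fundForm J₀ g₀ (a + b) c = fundForm J₀ g₀ a c + fundForm J₀ g₀ b c :=
      fun a b c => by simp [fundForm]
    have hadd' : ∀ a b c, fundForm J₀ g₀ c (a + b) = fundForm J₀ g₀ c a + fundForm J₀ g₀ c b :=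
      fun a b c => by simp [fundForm]
    simp only [ceD_fundFormSq rfl, fundFormSqApply]
    fin_cases i <;> simp [hadd, hadd'] <;> ring
  map_update_smul' := by
    intro inst X i c x
    obtain rfl : inst = instDecidableEqFin 5 := Subsingleton.elim _ _
    have hsmul : ∀ a b, fundForm J₀ g₀ (c • a) b = c * fundForm J₀ g₀ a b :=
      fun a b => by simp [fundForm]
    have hsmul' : ∀ a b, fundForm J₀ g₀ a (c • b) = c * fundForm J₀ g₀ a b :=
      fun a b => by simp [fundForm]
    simp only [ceD_fundFormSq rfl, fundFormSqApply]
    fin_cases i <;> simp [hsmul, hsmul'] <;> ring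
  map_eq_zero_of_eq' X i j h hij := by
    have hF := fundForm_swap hJ₀ hg₀
    have hF0 : ∀ a, fundForm J₀ g₀ a a = 0 := fun a => by have := hF a a; linarith
    have hneg : ∀ a b, fundForm J₀ g₀ (-a) b = -fundForm J₀ g₀ a b := fun a b => by simp [fundForm]
    have hz : ∀ a, fundForm J₀ g₀ 0 a = 0 := fun a => by simp [fundForm]
    have hl : ∀ a b : L, ⁅a, b⁆ = -⁅b, a⁆ := fun a b => (lie_skew a b).symm
    simp only [ceD_fundFormSq rfl, fundFormSqApply]
    wlog hlt : i < j generalizing i j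
    · exact this j i h.symm hij.symm (lt_of_le_of_ne (not_lt.1 hlt) hij.symm)
    fin_cases i <;> fin_cases j <;> simp at hlt <;> simp at h <;>
    · simp only [← h, hF0, hz, lie_self, hneg, hF (X 1) (X 0), hF (X 2) (X 0), hF (X 2) (X 1),
        hF (X 3) (X 0), hF (X 3) (X 1), hF (X 3) (X 2), hl (X 1) (X 0), hl (X 2) (X 0),
        hl (X 2) (X 1), hl (X 3) (X 0), hl (X 3) (X 1), hl (X 3) (X 2)]
      ring

end Balanced

/-! ### Unimodular complex Lie algebras are balanced -/

section Unimodular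
open LieForms LieHermitian SixDim

variable {L : Type*} [LieRing L] [LieAlgebra ℝ L]

lemma trace_eq_sum_repr (b : Basis (Fin 6) ℝ L) (f : L →ₗ[ℝ] L) :
    LinearMap.trace ℝ L f = ∑ i, b.repr (f (b i)) i := by
  rw [LinearMap.trace_eq_matrix_trace ℝ b]
  simp [Matrix.trace, LinearMap.toMatrix_apply]

/-- The three Lie algebras are unimodular. -/
lemma trace_ad_eq_zero [FiniteDimensional ℝ L] (hL : IsH5 L ∨ IsG8 L ∨ IsSO31 L) (x : L) :
    LinearMap.trace ℝ L (LieModule.toEnd ℝ L L x) = 0 := by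
  have key : ∀ e : Basis (Fin 6) ℝ (L →ₗ[ℝ] ℝ), ∃ b : Fin 6 → L,
      (∀ i j, e i (b j) = if j = i then 1 else 0) ∧
      LinearMap.trace ℝ L (LieModule.toEnd ℝ L L x) = -∑ i, dOne (e i) x (b i) := fun e => by
    obtain ⟨b, hb⟩ := exists_dual_basis e
    refine ⟨b, fun i j => ?_, ?_⟩
    · rw [← hb, b.repr_self, Finsupp.single_apply]
    · rw [trace_eq_sum_repr b, ← Finset.sum_neg_distrib]
      exact Finset.sum_congr rfl fun i _ => by simp [hb, dOne]
  rcases hL with ⟨e, h0, h1, h2, h3, h4, h5⟩ | ⟨e, h0, h1, h2, h3, h4, h5⟩ |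
    ⟨e, h0, h1, h2, h3, h4, h5⟩ <;>
  · obtain ⟨b, hb, ht⟩ := key e
    rw [ht]
    simp [Fin.sum_univ_six, h0, h1, h2, h3, h4, h5, wedge, hb]

variable {J₀ : L →ₗ[ℝ] L} {g₀ : L →ₗ[ℝ] L →ₗ[ℝ] ℝ}

lemma exists_unit_orthogonal (hL : finrank ℝ L = 6) (hg₀ : IsHermitianMetric J₀ g₀) {k : ℕ}
    (hk : k < 6) (w : Fin k → L) : ∃ v, g₀ v v = 1 ∧ ∀ i, g₀ v (w i) = 0 := by
  have : FiniteDimensional ℝ L := FiniteDimensional.of_finrank_eq_succ hL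
  let f : L →ₗ[ℝ] (Fin k → ℝ) := LinearMap.pi fun i => g₀.flip (w i)
  have hf : LinearMap.ker f ≠ ⊥ := LinearMap.ker_ne_bot_of_finrank_lt (by simpa [hL] using hk)
  obtain ⟨v, hv, hv0⟩ := (Submodule.ne_bot_iff _).1 hf
  have hpos := hg₀.pos v hv0
  refine ⟨(√(g₀ v v))⁻¹ • v, ?_, fun i => ?_⟩
  · simp only [map_smul, LinearMap.smul_apply, smul_eq_mul, ← mul_assoc, ← mul_inv]
    rw [Real.mul_self_sqrt hpos.le, inv_mul_cancel₀ hpos.ne']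
  · have : g₀ v (w i) = 0 := congrFun (LinearMap.mem_ker.1 hv) i
    simp [this]

lemma exists_unitary_basis (hL : finrank ℝ L = 6) (hJ₀ : IsComplexStructure J₀)
    (hg₀ : IsHermitianMetric J₀ g₀) : ∃ (u v w : L) (b : Basis (Fin 6) ℝ L),
      ⇑b = ![u, J₀ u, v, J₀ v, w, J₀ w] ∧ ∀ i j, g₀ (b i) (b j) = if i = j then 1 else 0 := by
  have : FiniteDimensional ℝ L := FiniteDimensional.of_finrank_eq_succ hL
  have hJg : ∀ X Y, g₀ (J₀ X) Y = - g₀ X (J₀ Y) := fun X Y => by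
    have := hg₀.compat X (J₀ Y)
    rw [hJ₀.sq, map_neg] at this
    linarith
  have hJ0 : ∀ X, g₀ X (J₀ X) = 0 := fun X => by
    have := hJg X X
    rw [hg₀.symm] at this
    linarith
  obtain ⟨u, hu, -⟩ := exists_unit_orthogonal hL hg₀ (k := 0) (by norm_num) ![]
  obtain ⟨v, hv, hvo⟩ := exists_unit_orthogonal hL hg₀ (by norm_num) ![u, J₀ u]
  obtain ⟨w, hw, hwo⟩ := exists_unit_orthogonal hL hg₀ (by norm_num) ![u, J₀ u, v, J₀ v]
  have v0 : g₀ v u = 0 := hvo 0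
  have v1 : g₀ v (J₀ u) = 0 := hvo 1
  have w0 : g₀ w u = 0 := hwo 0
  have w1 : g₀ w (J₀ u) = 0 := hwo 1
  have w2 : g₀ w v = 0 := hwo 2
  have w3 : g₀ w (J₀ v) = 0 := hwo 3
  have v0' : g₀ u v = 0 := by rw [hg₀.symm, v0]
  have v1' : g₀ u (J₀ v) = 0 := by rw [hg₀.symm, hJg, v1, neg_zero]
  have w0' : g₀ u w = 0 := by rw [hg₀.symm, w0]
  have w1' : g₀ u (J₀ w) = 0 := by rw [hg₀.symm, hJg, w1, neg_zero]
  have w2' : g₀ v w = 0 := by rw [hg₀.symm, w2]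
  have w3' : g₀ v (J₀ w) = 0 := by rw [hg₀.symm, hJg, w3, neg_zero]
  set c : Fin 6 → L := ![u, J₀ u, v, J₀ v, w, J₀ w] with hc
  have horth : ∀ i j, g₀ (c i) (c j) = if i = j then 1 else 0 := fun i j => by
    fin_cases i <;> fin_cases j <;> simp [hg₀.compat, *]
  have hli : LinearIndependent ℝ c := by
    refine Fintype.linearIndependent_iff.2 fun a ha i => ?_
    have := congrArg (fun x => g₀ x (c i)) ha
    simpa [horth] using this
  exact ⟨u, v, w, basisOfLinearIndependentOfCardEqFinrank hli (by simp [hL]), by simp [hc],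
    fun i j => by simpa using horth i j⟩

/-- On a unitary pair `u, v` and a vector `x` orthogonal to its complex span, `d(F ∧ F)` is, up to
a factor, the trace of `ad x` on that span. -/
lemma ceD_fundFormSq_of_unitary (hJ₀ : IsComplexStructure J₀) (hg₀ : IsHermitianMetric J₀ g₀)
    (hP : IsComplexParallelizable J₀) {u v x : L} (uu : g₀ u u = 1) (vv : g₀ v v = 1)
    (uv : g₀ u v = 0) (juv : g₀ (J₀ u) v = 0) (xu : g₀ u x = 0) (jxu : g₀ (J₀ u) x = 0)
    (xv : g₀ v x = 0) (jxv : g₀ (J₀ v) x = 0) (ht : g₀ ⁅x, u⁆ u + g₀ ⁅x, v⁆ v = 0) :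
    ceD (fundFormSq J₀ g₀) ![u, J₀ u, v, J₀ v, x] = 0 := by
  have hP₁ : ∀ X Y : L, ⁅J₀ X, Y⁆ = J₀ ⁅X, Y⁆ := hP
  have hP₂ : ∀ X Y : L, ⁅X, J₀ Y⁆ = J₀ ⁅X, Y⁆ := fun X Y => by
    rw [← lie_skew, hP, ← lie_skew X Y, map_neg]
  have hR : ∀ X Y, g₀ X (J₀ Y) = - g₀ (J₀ X) Y := fun X Y => by
    have := hg₀.compat X (J₀ Y)
    rw [hJ₀.sq, map_neg] at this
    linarith
  have hux : ⁅u, x⁆ = -⁅x, u⁆ := (lie_skew u x).symm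
  have hvx : ⁅v, x⁆ = -⁅x, v⁆ := (lie_skew v x).symm
  rw [ceD_fundFormSq rfl]
  simp only [fundFormSqApply, fundForm, Matrix.cons_val]
  simp only [hP₁, hP₂, hJ₀.sq, hux, hvx, lie_self, map_neg, map_zero, LinearMap.neg_apply,
    LinearMap.zero_apply, hR, neg_neg, uu, vv, uv, juv, xu, jxu, xv, jxv]
  linear_combination -4 * ht

/-- An alternating five-form on a six-dimensional space vanishes as soon as it vanishes on the
basis with each of its vectors omitted; `c m` lists the indices other than `m` in any order. -/
lemma alternatingMap_eq_zero_of_omit (b : Basis (Fin 6) ℝ L) (f : L [⋀^Fin 5]→ₗ[ℝ] ℝ)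
    (c : Fin 6 → Fin 5 → Fin 6) (hc : ∀ m i, i ≠ m → ∃ k, c m k = i)
    (h : ∀ m, f (fun k => b (c m k)) = 0) : f = 0 := by
  refine Basis.ext_alternating b fun s hs => ?_
  obtain ⟨m, hm⟩ : ∃ m, m ∉ Set.range s := by
    by_contra! h
    have := Fintype.card_le_of_surjective s h
    simp at this
  have hσ : ∀ i, ∃ k, c m k = s i := fun i => hc m (s i) fun h => hm ⟨i, h⟩
  choose σ hσ using hσ
  have hinj : Function.Injective σ := fun i j h => hs (by rw [← hσ, ← hσ, h])
  have hcomp : (fun i => b (s i)) = (fun k => b (c m k)) ∘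
      Equiv.ofBijective σ (Finite.injective_iff_bijective.1 hinj) :=
    funext fun i => by simp [hσ]
  rw [hcomp, AlternatingMap.map_perm, AlternatingMap.zero_apply, h, smul_zero]

/-- On a unimodular complex Lie algebra every Hermitian metric is balanced: `d(F ∧ F)` on a unitary
basis with one vector omitted is the trace of `ad` of the partner `± J₀` of the omitted vector. -/
theorem isBalanced_of_isComplexParallelizable (hL : finrank ℝ L = 6) (hJ₀ : IsComplexStructure J₀)
    (hg₀ : IsHermitianMetric J₀ g₀) (hP : IsComplexParallelizable J₀)
    (htr : ∀ x : L, LinearMap.trace ℝ L (LieModule.toEnd ℝ L L x) = 0) : IsBalanced J₀ g₀ := by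
  obtain ⟨u, v, w, b, hb, horth⟩ := exists_unitary_basis hL hJ₀ hg₀
  have hP' : ∀ X Y : L, ⁅X, J₀ Y⁆ = J₀ ⁅X, Y⁆ := fun X Y => by
    rw [← lie_skew, hP, ← lie_skew X Y, map_neg]
  have hrepr : ∀ x i, b.repr x i = g₀ x (b i) := fun x i => by
    conv_rhs => rw [← b.sum_repr x]
    simp only [map_sum, map_smul, LinearMap.sum_apply, LinearMap.smul_apply, horth]
    simp
  have b0 : b 0 = u := by simp [hb]
  have b1 : b 1 = J₀ u := by simp [hb]
  have b2 : b 2 = v := by simp [hb]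
  have b3 : b 3 = J₀ v := by simp [hb]
  have b4 : b 4 = w := by simp [hb]
  have b5 : b 5 = J₀ w := by simp [hb]
  have htr' : ∀ x : L, g₀ ⁅x, u⁆ u + g₀ ⁅x, v⁆ v + g₀ ⁅x, w⁆ w = 0 := fun x => by
    have := htr x
    rw [trace_eq_sum_repr b] at this
    simp only [hrepr, LieModule.toEnd_apply_apply, Fin.sum_univ_six, b0, b1, b2, b3, b4, b5, hP',
      hg₀.compat] at this
    linarith
  have hself : ∀ x : L, ⁅J₀ x, x⁆ = 0 := fun x => by rw [hP, lie_self, map_zero]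
  have hpair : ∀ i j k l n : Fin 6, b j = J₀ (b i) → b l = J₀ (b k) →
      i ≠ k ∧ j ≠ k ∧ i ≠ n ∧ j ≠ n ∧ k ≠ n ∧ l ≠ n →
      g₀ ⁅b n, b i⁆ (b i) + g₀ ⁅b n, b k⁆ (b k) = 0 →
      dFundFormSq hJ₀ hg₀ (fun t => b (![i, j, k, l, n] t)) = 0 := by
    rintro i j k l n hj hl ⟨h1, h2, h3, h4, h5, h6⟩ ht
    have hvec : (fun t => b (![i, j, k, l, n] t)) = ![b i, b j, b k, b l, b n] :=
      funext fun t => by fin_cases t <;> rfl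
    rw [hvec, hj, hl]
    refine ceD_fundFormSq_of_unitary hJ₀ hg₀ hP ?_ ?_ ?_ ?_ ?_ ?_ ?_ ?_ ht <;>
      simp only [horth, ← hj, ← hl, h1, h2, h3, h4, h5, h6, if_true, if_false]
  have p0 : b 1 = J₀ (b 0) := by rw [b0, b1]
  have p2 : b 3 = J₀ (b 2) := by rw [b2, b3]
  have p4 : b 5 = J₀ (b 4) := by rw [b4, b5]
  have tu := htr' u
  have tv := htr' v
  have tw := htr' w
  have tu' := htr' (J₀ u)
  have tv' := htr' (J₀ v)
  have tw' := htr' (J₀ w)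
  simp only [lie_self, hself, map_zero, LinearMap.zero_apply, zero_add, add_zero]
    at tu tv tw tu' tv' tw'
  have key : dFundFormSq hJ₀ hg₀ = 0 := by
    -- The five basis vectors other than the `m`-th, with the partner of the `m`-th at the end.
    refine alternatingMap_eq_zero_of_omit b _ ![![2, 3, 4, 5, 1], ![2, 3, 4, 5, 0],
      ![0, 1, 4, 5, 3], ![0, 1, 4, 5, 2], ![0, 1, 2, 3, 5], ![0, 1, 2, 3, 4]] (by decide) ?_
    simp only [Fin.forall_fin_succ, Matrix.cons_val, IsEmpty.forall_iff, and_true]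
    exact ⟨hpair 2 3 4 5 1 p2 p4 (by decide) (by rwa [b1, b2, b4]),
      hpair 2 3 4 5 0 p2 p4 (by decide) (by rwa [b0, b2, b4]),
      hpair 0 1 4 5 3 p0 p4 (by decide) (by rwa [b3, b0, b4]),
      hpair 0 1 4 5 2 p0 p4 (by decide) (by rwa [b2, b0, b4]),
      hpair 0 1 2 3 5 p0 p2 (by decide) (by rwa [b5, b0, b2]),
      hpair 0 1 2 3 4 p0 p2 (by decide) (by rwa [b4, b0, b2])⟩
  exact congrArg (fun f : L [⋀^Fin 5]→ₗ[ℝ] ℝ => ⇑f) key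

end Unimodular

end

/-! ### The Chern connection of the quotient -/

open LieForms SixDim LieHermitian HomogeneousSpace HermitianManifold in
theorem corollary6p1
    {G : Type*} [TopologicalSpace G] [ChartedSpace E6 G] [Group G] [LieGroup (𝓡 6) ∞ G]
    [T2Space G] [SimplyConnectedSpace G]
    {M : Type*} [TopologicalSpace M] [ChartedSpace E6 M] [IsManifold (𝓡 6) ∞ M]
    [T2Space M] [CompactSpace M]
    (Γ : Subgroup G) [DiscreteTopology Γ] (p : G → M) (hp : IsQuotientBy Γ p)
    (J₀ : GroupLieAlgebra (𝓡 6) G →ₗ[ℝ] GroupLieAlgebra (𝓡 6) G)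
    (hJ₀ : IsComplexStructure J₀) (hΨ : HasClosedThreeZeroForm J₀)
    (g₀ : GroupLieAlgebra (𝓡 6) G →ₗ[ℝ] GroupLieAlgebra (𝓡 6) G →ₗ[ℝ] ℝ)
    (hg₀ : IsHermitianMetric J₀ g₀)
    (J : ∀ x : M, TangentSpace (𝓡 6) x →ₗ[ℝ] TangentSpace (𝓡 6) x)
    (hJ : IsInducedEnd p J₀ J)
    (g : ∀ x : M, TangentSpace (𝓡 6) x →ₗ[ℝ] TangentSpace (𝓡 6) x →ₗ[ℝ] ℝ)
    (hg : IsInducedMetric p g₀ g)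
    (D : Connection M) (hD : IsChernConnection J g D) :
    ((IsH5 (GroupLieAlgebra (𝓡 6) G) ∨ IsG8 (GroupLieAlgebra (𝓡 6) G) ∨
          IsSO31 (GroupLieAlgebra (𝓡 6) G)) →
        IsComplexParallelizable J₀ →
        IsBalanced J₀ g₀ ∧ IsInstanton J g D ∧ IsFlat D) ∧
    ((IsG1 (GroupLieAlgebra (𝓡 6) G) ∨ (∃ α : ℝ, 0 < α ∧ IsG2 (GroupLieAlgebra (𝓡 6) G) α) ∨
          IsG8 (GroupLieAlgebra (𝓡 6) G)) →
        IsDiagonal J₀ g₀ →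
        IsInstanton J g D ∧ IsFlat D) ∧
    (IsG2 (GroupLieAlgebra (𝓡 6) G) 0 →
        IsKahler J₀ g₀ →
        IsInstanton J g D ∧ IsFlat D) := by
  have hdim : finrank ℝ (GroupLieAlgebra (𝓡 6) G) = 6 := finrank_euclideanSpace_fin
  have : FiniteDimensional ℝ (GroupLieAlgebra (𝓡 6) G) := FiniteDimensional.of_finrank_eq_succ hdim
  have hE := hp.isInvariantFrame_quotientFrame
  have hJE : ∀ x v, J x (hp.quotientFrame x v) = hp.quotientFrame x (J₀ v) := fun x v => by
    obtain ⟨a, rfl⟩ := hp.surjective x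
    rw [hp.quotientFrame_apply, hp.quotientFrame_apply, hJ]
  have hgE : ∀ x v w, g x (hp.quotientFrame x v) (hp.quotientFrame x w) = g₀ v w := fun x v w => by
    obtain ⟨a, rfl⟩ := hp.surjective x
    rw [hp.quotientFrame_apply, hp.quotientFrame_apply, hg]
  refine ⟨fun hL hP => ⟨?_, ?_⟩, fun _ hd => ?_, fun hL hK => ?_⟩
  · exact isBalanced_of_isComplexParallelizable hdim hJ₀ hg₀ hP (trace_ad_eq_zero hL)
  · exact hE.flat_and_instanton hJ₀ hg₀ hJE hgE hD (isFlatChernForm_zero hJ₀ hP g₀)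
  · obtain ⟨φ, B, hB⟩ := exists_isFlatChernForm_of_isDiagonal hdim hg₀ hd
    exact hE.flat_and_instanton hJ₀ hg₀ hJE hgE hD hB
  · obtain ⟨φ, B, hB⟩ := exists_isFlatChernForm_of_isG2_zero hJ₀ hg₀ hK hL
    exact hE.flat_and_instanton hJ₀ hg₀ hJE hgE hD hB
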